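/- **Setting.** Let $\Gamma$ be a finite connected graph (loops and multiple edges allowed) without vertices of degree one, let $E\Gamma=\{e_1,\dots,e_n\}$ be the set of its oriented edges, let $F$ be a free group of finite rank $k\ge 2$ and let $\alpha:F\to\pi_1(\Gamma,p)$ be an isomorphism. Let $X=\widetilde\Gamma$ be the universal covering tree, on which $F$ acts through $\alpha$. Set $m_{ij}=1$ if $e_ie_j$ is a reduced path in $\Gamma$ (that is, $e_j$ starts where $e_i$ ends and $e_j\ne e_i^{-1}$), and $m_{ij}=0$ otherwise. A *quasi-metric structure* $\mathcal L$ on $\Gamma$ assigns to each $e_i$ a length $L_i=L(e_i)\ge 0$; it is *positive* if all $L(e)>0$, *semi-metric* if $L(e)=L(e^{-1})$ for all $e$, and *non-singular* if there is a maximal tree $T\subseteq\Gamma$ with $L(e)>0$ for all $e\in E(\Gamma-T)$. A semi-metric structure defines a semi-metric $d=d_{\mathcal L}$ on $X$, for which the length of an edge is the length of its image in $\Gamma$; the *critical exponent* of $(X,d_{\mathcal L})$ is the number $h\ge0$ such that, for every $x$, $\sum_{g\in F}e^{-\sigma d(x,gx)}$ converges for $\sigma>h$ and diverges for $\sigma<h$.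 A *$\sigma$-dimensional conformal density* is a family $(\mu_x)_x$ of finite regular Borel measures on the space of ends $\partial X$ such that $\mu_{gx}=g_*\mu_x$ for $g\in F$, $\frac{d\mu_x}{d\mu_y}(\xi)=e^{-\sigma B_\xi(x,y)}$ with $B_\xi(x,y)=\lim_{z\to\xi}(d(x,z)-d(y,z))$, and $\mu_x=\mu_y$ if $d(x,y)=0$. For such a family and $e\in E\Gamma$ put $w_e=\mu_x(\mathrm{Cyl}_x(f))$, where $f$ is any lift of $e$ to $X$, $x$ is its origin, and $\mathrm{Cyl}_x(f)$ is the set of the ends $\zeta$ such that the ray $[x,\zeta]$ starts with $f$; this does not depend on the lift. Consider the system of $n+1$ equations $$F_i:=e^{-sL_i}(m_{i1}y_1+\dots+m_{in}y_n)-y_i=0\quad(1\le i\le n),\qquad F_{n+1}:=y_1^2+\dots+y_n^2-1=0\tag{!}$$ in the $2n+1$ real variables $\overline L=(L_1,\dots,L_n)$, $\overline y=(y_1,\dots,y_n)$, $s$. **Statement.** Let $\overline L^{(0)}$ be a non-singular semi-metric structure or a positive quasi-metric structure on $\Gamma$, and let $s^{(0)}>0$ and $y_i^{(0)}>0$ $(1\le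 i\le n)$ be such that $z^{(0)}=(\overline L^{(0)},\overline y^{(0)},s^{(0)})$ satisfies (!). Then: 1. The Jacobian matrix $J$ of $F_1,\dots,F_{n+1}$ with respect to $y_1,\dots,y_n,s$ satisfies $\det J|_{z^{(0)}}\ne0$. 2. There are an open neighbourhood $U$ of $\overline L^{(0)}$ in $\mathbb R^n$ and real-analytic functions $s(\overline L)$, $y_1(\overline L),\dots,y_n(\overline L)$ on $U$ such that $(\overline L,\overline y(\overline L),s(\overline L))$ satisfies (!) for every $\overline L\in U$, and $\overline y(\overline L^{(0)})=\overline y^{(0)}$, $s(\overline L^{(0)})=s^{(0)}$. Moreover, whenever $\overline L\in U$ is a non-singular semi-metric structure $\mathcal L$ on $\Gamma$, the number $s(\overline L)$ is the critical exponent of $(X,d_{\mathcal L})$, and, for every nonzero conformal density of any dimension $\sigma>0$ for $(X,d_{\mathcal L})$ (in particular for every family of Patterson–Sullivan measures), $(y_1(\overline L),\dots,y_n(\overline L))$ is a scalar multiple of $(w_{e_1},\dots,w_{e_n})$. -/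

import Mathlib

open Filter Topology MeasureTheory

/-- A graph with vertex set `V` (loops and multiple edges are allowed). `A` is the set of
geometric (non-oriented) edges; `src` and `tgt` record the two ends of each geometric edge with
respect to an auxiliary reference orientation. -/
structure Multigraph (V A : Type*) where
  src : A → V
  tgt : A → V

namespace Multigraph

variable {V A : Type*}

/-- An oriented edge is a geometric edge with one of its two orientations: `(a, true)` runs from
`src a` to `tgt a` and `(a, false)` is its inverse. So `A × Bool` is the set of all oriented edges
(even a loop gives two of them). -/
abbrev Dart (A : Type*) := A × Bool

/-- The inverse `e⁻¹` of an oriented edge. -/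
def rev (e : Dart A) : Dart A := (e.1, !e.2)

/-- The origin `o(e)` of an oriented edge. -/
def orig (Γ : Multigraph V A) (e : Dart A) : V := if e.2 then Γ.src e.1 else Γ.tgt e.1

/-- The terminus `t(e)` of an oriented edge. -/
def term (Γ : Multigraph V A) (e : Dart A) : V := if e.2 then Γ.tgt e.1 else Γ.src e.1

/-- `Γ.IsPath u v l`: the sequence `l` of oriented edges is an edge-path from `u` to `v`. -/
def IsPath (Γ : Multigraph V A) : V → V → List (Dart A) → Prop
  | u, v, [] => u = v
  | u, v, e :: l => Γ.orig e = u ∧ Γ.IsPath (Γ.term e) v l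

/-- There is no back-tracking `e e⁻¹`. -/
def IsReduced (l : List (Dart A)) : Prop := l.IsChain fun e e' => e' ≠ rev e

/-- The path consisting of `e` followed by `e'` is a reduced path of `Γ`, that is, `e' ∈ b(e)`. -/
def Follows (Γ : Multigraph V A) (e e' : Dart A) : Prop := Γ.orig e' = Γ.term e ∧ e' ≠ rev e

def IsConnected (Γ : Multigraph V A) : Prop := ∀ u v, ∃ l, Γ.IsPath u v l

/-- The degree of a vertex is the number of oriented edges with this origin (a loop counts
twice). -/
noncomputable def degree (Γ : Multigraph V A) (v : V) : ℕ := {e : Dart A | Γ.orig e = v}.ncard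

/-- The geometric edges in `T`, together with all the vertices, form a maximal tree of the
connected graph `Γ`: any two vertices are joined by a unique reduced path with edges in `T`. -/
def IsMaximalTree (Γ : Multigraph V A) (T : Set A) : Prop :=
  ∀ u v, ∃! l, Γ.IsPath u v l ∧ IsReduced l ∧ ∀ e ∈ l, e.1 ∈ T

/-! ### Length structures -/

/-- A quasi-metric structure: a length `L e ≥ 0` for each oriented edge. -/
def IsQuasiMetric (L : Dart A → ℝ) : Prop := ∀ e, 0 ≤ L e

/-- A quasi-metric structure is positive if all the lengths are positive. -/
def IsPositive (L : Dart A → ℝ) : Prop := ∀ e, 0 < L e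

/-- A semi-metric structure: a quasi-metric structure with `L(e) = L(e⁻¹)`. -/
def IsSemiMetric (L : Dart A → ℝ) : Prop := IsQuasiMetric L ∧ ∀ e, L (rev e) = L e

/-- Non-singular: the lengths are positive outside some maximal tree. -/
def IsNonsingular (Γ : Multigraph V A) (L : Dart A → ℝ) : Prop :=
  ∃ T, Γ.IsMaximalTree T ∧ ∀ e : Dart A, e.1 ∉ T → 0 < L e

/-! ### The system of equations and its Jacobian -/

open Classical in
/-- The adjacency matrix of the reduced line graph: `m e e' = 1` if `e e'` is a reduced path and
`m e e' = 0` otherwise. -/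
noncomputable def lineMatrix (Γ : Multigraph V A) : Matrix (Dart A) (Dart A) ℝ :=
  fun e e' => if Γ.Follows e e' then 1 else 0

/-- The functions `F_e(L, y, s) = exp (-s L(e)) ∑ m e e' y_e' - y_e`, one for each oriented edge
`e`, and the normalizing function `∑ y_e ^ 2 - 1` (with index `Sum.inr ()`). -/
noncomputable def sysFun [Fintype A] (Γ : Multigraph V A) (L y : Dart A → ℝ) (s : ℝ) :
    Dart A ⊕ Unit → ℝ
  | Sum.inl e => Real.exp (-s * L e) * ∑ e', Γ.lineMatrix e e' * y e' - y e
  | Sum.inr _ => ∑ e, y e ^ 2 - 1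

/-- The matrix of the partial derivatives of these functions with respect to the variables `y_e`
(columns `Sum.inl e`) and `s` (the column `Sum.inr ()`), at the point `(L, y, s)`. -/
noncomputable def jacobian [Fintype A] [DecidableEq A] (Γ : Multigraph V A) (L y : Dart A → ℝ)
    (s : ℝ) : Matrix (Dart A ⊕ Unit) (Dart A ⊕ Unit) ℝ :=
  fun i j => match j with
    | Sum.inl e => deriv (fun t => Γ.sysFun L (Function.update y e t) s i) (y e)
    | Sum.inr _ => deriv (fun t => Γ.sysFun L y t i) s

/-! ### The ends of a graph which is a tree, and distances -/

/-- The length of an edge-path. -/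
def pathLength (L : Dart A → ℝ) (l : List (Dart A)) : ℝ := (l.map L).sum

/-- The distance in a tree with edge lengths `L`: the length of the unique reduced path `[x, y]`
(the set below has exactly one element if the graph is a tree). -/
noncomputable def treeDist (X : Multigraph V A) (L : Dart A → ℝ) (x y : V) : ℝ :=
  sInf {r | ∃ l, X.IsPath x y l ∧ IsReduced l ∧ pathLength L l = r}

/-- Infinite reduced edge-paths. -/
def Ray (X : Multigraph V A) : Type _ := {r : ℕ → Dart A // ∀ n, X.Follows (r n) (r (n + 1))}

/-- Two rays of a tree define the same end if they eventually coincide, up to a shift. -/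
instance raySetoid (X : Multigraph V A) : Setoid X.Ray where
  r r₁ r₂ := ∃ m n, ∀ k, r₁.1 (m + k) = r₂.1 (n + k)
  iseqv :=
    { refl := fun _ => ⟨0, 0, fun _ => rfl⟩
      symm := fun ⟨m, n, h⟩ => ⟨n, m, fun k => (h k).symm⟩
      trans := fun {r₁ r₂ r₃} ⟨m, n, h⟩ ⟨m', n', h'⟩ => ⟨m + m', n' + n, fun k => by
        have h1 := h (m' + k)
        have h2 := h' (n + k)
        rw [show m + m' + k = m + (m' + k) by omega, h1,
          show n + (m' + k) = m' + (n + k) by omega, h2, add_assoc]⟩ }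

/-- The space of ends `∂X` of a tree `X`. -/
def Boundary (X : Multigraph V A) : Type _ := Quotient X.raySetoid

/-- The cylinder `Cyl_x(f)`, where `x` is the origin of the oriented edge `f`: the set of the ends
`ζ` such that the ray `[x, ζ]` starts with `f`. -/
def cyl (X : Multigraph V A) (f : Dart A) : Set X.Boundary :=
  {ζ | ∃ r : X.Ray, r.1 0 = f ∧ Quotient.mk X.raySetoid r = ζ}

/-- The ends-space topology, generated by the cylinders. -/
instance (X : Multigraph V A) : TopologicalSpace X.Boundary :=
  TopologicalSpace.generateFrom (Set.range X.cyl)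

instance (X : Multigraph V A) : MeasurableSpace X.Boundary := borel _

instance (X : Multigraph V A) : BorelSpace X.Boundary := ⟨rfl⟩

/-- The vertices of the half-tree beyond `f`: those `z` such that the reduced path from the origin
of `f` to `z` starts with `f`. -/
def halfTree (X : Multigraph V A) (f : Dart A) : Set V :=
  {z | ∃ l, X.IsPath (X.orig f) z (f :: l) ∧ IsReduced (f :: l)}

/-- The filter `z → ζ` on the vertices of a tree, for an end `ζ`. -/
def nhdsEnd (X : Multigraph V A) (ζ : X.Boundary) : Filter V :=
  ⨅ f ∈ {f : Dart A | ζ ∈ X.cyl f}, 𝓟 (X.halfTree f)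

/-- The Busemann function `B_ζ(x, y) = lim_{z → ζ} (d(x, z) - d(y, z))`. (In a tree the function
under the limit is constant for `z` close to `ζ`.) -/
noncomputable def busemann (X : Multigraph V A) (L : Dart A → ℝ) (ζ : X.Boundary) (x y : V) : ℝ :=
  limUnder (X.nhdsEnd ζ) fun z => X.treeDist L x z - X.treeDist L y z

/-! ### Fundamental group and universal covering tree -/

theorem IsPath.append {Γ : Multigraph V A} {u v w : V} {l l' : List (Dart A)}
    (h : Γ.IsPath u v l) (h' : Γ.IsPath v w l') : Γ.IsPath u w (l ++ l') := by
  induction l generalizing u with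
  | nil => cases h; exact h'
  | cons e l ih => exact ⟨h.1, ih h.2⟩

theorem IsPath.invRev {Γ : Multigraph V A} {u v : V} {l : List (Dart A)}
    (h : Γ.IsPath u v l) : Γ.IsPath v u (FreeGroup.invRev l) := by
  induction l generalizing u with
  | nil => exact Eq.symm h
  | cons e l ih =>
    rw [FreeGroup.invRev_cons]
    refine (ih h.2).append ?_
    rcases e with ⟨a, _ | _⟩ <;> exact ⟨rfl, h.1⟩

/-- The fundamental group `π₁(Γ, p)`. An edge-path is a word in the geometric edges and their
inverses, and two edge-paths with the same ends are homotopic if and only if they differ by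
insertions and deletions of pairs `e e⁻¹`, that is, if they define the same element of the free
group on the set of geometric edges. So the homotopy classes of closed edge-paths at `p` form a
subgroup of this free group. -/
def fundGroup (Γ : Multigraph V A) (p : V) : Subgroup (FreeGroup A) where
  carrier := {g | ∃ l, Γ.IsPath p p l ∧ FreeGroup.mk l = g}
  mul_mem' := by
    rintro _ _ ⟨l, hl, rfl⟩ ⟨l', hl', rfl⟩
    exact ⟨l ++ l', hl.append hl', FreeGroup.mul_mk.symm⟩
  one_mem' := ⟨[], rfl, rfl⟩
  inv_mem' := by
    rintro _ ⟨l, hl, rfl⟩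
    exact ⟨FreeGroup.invRev l, hl.invRev, FreeGroup.inv_mk.symm⟩

/-- The vertices of the universal cover of `Γ`: the homotopy classes of edge-paths that start at
the base point `p`, each recorded together with its end point. -/
def CoverVertex (Γ : Multigraph V A) (p : V) : Type _ :=
  {x : FreeGroup A × V // ∃ l, Γ.IsPath p x.2 l ∧ FreeGroup.mk l = x.1}

/-- The geometric edges of the universal cover: over `a`, there is one for each vertex `x` lying
over the source of `a`. -/
def CoverEdge (Γ : Multigraph V A) (p : V) : Type _ :=
  {z : Γ.CoverVertex p × A // z.1.1.2 = Γ.src z.2}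

/-- The universal cover `X` of `Γ` (a tree if `Γ` is connected): the edge over `a` with source
`x` has target `x · a`. -/
def cover (Γ : Multigraph V A) (p : V) : Multigraph (Γ.CoverVertex p) (Γ.CoverEdge p) where
  src z := z.1.1
  tgt z := ⟨(z.1.1.1.1 * FreeGroup.of z.1.2, Γ.tgt z.1.2), by
    obtain ⟨⟨⟨⟨g, v⟩, l, hl, hg⟩, a⟩, ha⟩ := z
    refine ⟨l ++ [(a, true)], hl.append ⟨ha.symm, rfl⟩, ?_⟩
    simp only at hg ⊢
    rw [← hg]
    exact FreeGroup.mul_mk.symm⟩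

/-- The covering map on oriented edges. -/
def proj (Γ : Multigraph V A) (p : V) (f : Dart (Γ.CoverEdge p)) : Dart A := (f.1.1.2, f.2)

/-- The lift to the universal cover of a length structure on `Γ`. -/
def liftLength (Γ : Multigraph V A) (p : V) (L : Dart A → ℝ) : Dart (Γ.CoverEdge p) → ℝ :=
  fun f => L (Γ.proj p f)

/-- The distance `d` on the vertices of the universal cover. -/
noncomputable def coverDist (Γ : Multigraph V A) (p : V) (L : Dart A → ℝ)
    (x y : Γ.CoverVertex p) : ℝ :=
  (Γ.cover p).treeDist (Γ.liftLength p L) x y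

/-- The action of `π₁(Γ, p)` on the vertices of the universal cover. -/
def actVertex (Γ : Multigraph V A) (p : V) (g : Γ.fundGroup p) (x : Γ.CoverVertex p) :
    Γ.CoverVertex p :=
  ⟨(g.1 * x.1.1, x.1.2), by
    obtain ⟨l, hl, hg⟩ := g.2
    obtain ⟨l', hl', hx⟩ := x.2
    exact ⟨l ++ l', hl.append hl', by rw [← hg, ← hx, FreeGroup.mul_mk]⟩⟩

/-- The action of `π₁(Γ, p)` on the oriented edges of the universal cover. -/
def actDart (Γ : Multigraph V A) (p : V) (g : Γ.fundGroup p) (f : Dart (Γ.CoverEdge p)) :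
    Dart (Γ.CoverEdge p) :=
  (⟨(Γ.actVertex p g f.1.1.1, f.1.1.2), f.1.2⟩, f.2)

theorem orig_actDart (Γ : Multigraph V A) (p : V) (g : Γ.fundGroup p)
    (f : Dart (Γ.CoverEdge p)) :
    (Γ.cover p).orig (Γ.actDart p g f) = Γ.actVertex p g ((Γ.cover p).orig f) := by
  rcases f with ⟨z, _ | _⟩
  · exact Subtype.ext (Prod.ext (mul_assoc _ _ _) rfl)
  · rfl

theorem term_actDart (Γ : Multigraph V A) (p : V) (g : Γ.fundGroup p)
    (f : Dart (Γ.CoverEdge p)) :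
    (Γ.cover p).term (Γ.actDart p g f) = Γ.actVertex p g ((Γ.cover p).term f) := by
  rcases f with ⟨z, _ | _⟩
  · rfl
  · exact Subtype.ext (Prod.ext (mul_assoc _ _ _) rfl)

theorem actDart_injective (Γ : Multigraph V A) (p : V) (g : Γ.fundGroup p) :
    Function.Injective (Γ.actDart p g) := by
  intro f f' h
  have h1 : Γ.actVertex p g f.1.1.1 = Γ.actVertex p g f'.1.1.1 := congrArg (fun z => z.1.1.1) h
  have h2 : f.1.1.2 = f'.1.1.2 := congrArg (fun z => z.1.1.2) h
  have h3 : f.2 = f'.2 := congrArg (fun z => z.2) h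
  have h4 : f.1.1.1 = f'.1.1.1 := Subtype.ext (Prod.ext
    (mul_left_cancel (congrArg (fun z => z.1.1) h1)) (congrArg (fun z => z.1.2) h1))
  exact Prod.ext (Subtype.ext (Prod.ext h4 h2)) h3

/-- The action of `π₁(Γ, p)` on the rays of the universal cover. -/
def actRay (Γ : Multigraph V A) (p : V) (g : Γ.fundGroup p) (r : (Γ.cover p).Ray) :
    (Γ.cover p).Ray :=
  ⟨fun n => Γ.actDart p g (r.1 n), fun n =>
    ⟨by rw [orig_actDart, term_actDart, (r.2 n).1],
      fun h => (r.2 n).2 (Γ.actDart_injective p g h)⟩⟩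

/-- The action of `π₁(Γ, p)` on the ends of the universal cover. -/
def actBoundary (Γ : Multigraph V A) (p : V) (g : Γ.fundGroup p) :
    (Γ.cover p).Boundary → (Γ.cover p).Boundary :=
  Quotient.map' (Γ.actRay p g) fun _ _ ⟨m, n, h⟩ =>
    ⟨m, n, fun k => congrArg (Γ.actDart p g) (h k)⟩

/-! ### Critical exponent and conformal densities

A group `F` acts on the universal cover through an isomorphism `α : F ≃* π₁(Γ, p)`. -/

/-- `h` is the critical exponent: for every base point `x`, the Poincaré series
`∑ g, exp (-σ d(x, g x))` converges for `σ > h` and diverges for `σ < h`. -/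
def IsCriticalExponent (Γ : Multigraph V A) (p : V) {F : Type*} [Group F]
    (α : F ≃* Γ.fundGroup p) (L : Dart A → ℝ) (h : ℝ) : Prop :=
  0 ≤ h ∧ ∀ x : Γ.CoverVertex p,
    (∀ σ, h < σ →
      Summable fun g : F => Real.exp (-σ * Γ.coverDist p L x (Γ.actVertex p (α g) x))) ∧
    (∀ σ, σ < h →
      ¬ Summable fun g : F => Real.exp (-σ * Γ.coverDist p L x (Γ.actVertex p (α g) x)))

/-- A `σ`-dimensional conformal density on the boundary of the universal cover `X`, given by the
measures `μ x` for the vertices `x` of `X`. (The measures at the interior points of the edges are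
determined by those at the vertices through the condition on densities, and depend continuously on
the point; every family as below extends in this way.) -/
structure IsConformalDensity (Γ : Multigraph V A) (p : V) {F : Type*} [Group F]
    (α : F ≃* Γ.fundGroup p) (L : Dart A → ℝ) (σ : ℝ)
    (μ : Γ.CoverVertex p → Measure (Γ.cover p).Boundary) : Prop where
  finite : ∀ x, IsFiniteMeasure (μ x)
  regular : ∀ x, (μ x).Regular
  /-- Equivariance: `μ_{gx} = g_* μ_x`. -/
  equivariant : ∀ (g : F) (x : Γ.CoverVertex p) (S : Set (Γ.cover p).Boundary), MeasurableSet S →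
    μ (Γ.actVertex p (α g) x) S = μ x (Γ.actBoundary p (α g) ⁻¹' S)
  /-- The density of `μ x` with respect to `μ y` is `exp (-σ B_ζ(x, y))`. -/
  density : ∀ x y, μ x = (μ y).withDensity fun ζ =>
    ENNReal.ofReal (Real.exp (-σ * (Γ.cover p).busemann (Γ.liftLength p L) ζ x y))
  eq_of_dist : ∀ x y, Γ.coverDist p L x y = 0 → μ x = μ y

end Multigraph

/-!
Let `M` be the adjacency matrix of the reduced line graph of `Γ` and `B_s = diag (exp (-s L)) M`.
The equations say that `y` is a fixed vector of `B_s`, normalized to length one, and the proof is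
Perron-Frobenius theory for these matrices.

*Irreducibility* (`reflTransGen_follows`). Giving weight `1 / (deg - 1)` to each pair of consecutive
edges yields a doubly stochastic matrix, so reachability along reduced paths is a symmetric
relation. If some `e` reaches `e⁻¹`, connectedness of `Γ` gives a single class. Otherwise there are
two classes, inverse to each other, each closed reduced path stays in one of them, and the signed
number of edges embeds `π₁` into `ℤ`, which is impossible for a free group of rank at least two.

*The Jacobian* (`det_jacobian_ne_zero`). By irreducibility, `B_s` has a positive left fixed vector
`u`, and its right fixed vectors are the multiples of `y`. Pairing an element `(v, t)` of the kernel
of the Jacobian with `u` gives `t ∑ u_e L(e) y_e = 0`, hence `t = 0`; then `v` is a multiple of `y`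
orthogonal to `y`. The analytic implicit function theorem yields `y(L)` and `s(L)`, which remain
positive near `L₀`.

*The critical exponent* (`IsFixedVector.isCriticalExponent`). The sums of `exp (-s L(l))` over the
reduced paths `l` with `n + 1` edges starting with `e` satisfy the recursion given by `B_s`, so they
lie between two positive multiples of `y_e`, for all `n`. Reduced paths in `Γ` describe geodesics in
the covering tree, which compares these sums with the Poincaré series. It follows that the series
diverges at `s`. Non-singularity makes the length of a path grow linearly with the number of its
edges, so for `σ > s` the sums decay geometrically in `n`.

*Conformal densities* (`IsConformalDensity.exists_fixedVector`). The cylinder of an edge is the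
disjoint union of the cylinders of its successors, and the Busemann function of the two ends of the
edge is constant on it; thus the masses `w` of the cylinders form a nonzero nonnegative fixed vector
of `B_σ`. Pairing with `u` shows that `σ = s`, and uniqueness of the fixed vector that `y` is a
multiple of `w`.
-/

namespace Multigraph

variable {V A : Type*}

/-! ### Edge-paths and reduced words -/

@[simp] theorem rev_rev (e : Dart A) : rev (rev e) = e := by
  simp [rev]

theorem rev_injective : Function.Injective (rev : Dart A → Dart A) :=
  Function.LeftInverse.injective rev_rev

@[simp] theorem orig_rev (Γ : Multigraph V A) (e : Dart A) : Γ.orig (rev e) = Γ.term e := by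
  rcases e with ⟨a, _ | _⟩ <;> rfl

@[simp] theorem term_rev (Γ : Multigraph V A) (e : Dart A) : Γ.term (rev e) = Γ.orig e := by
  rcases e with ⟨a, _ | _⟩ <;> rfl

theorem follows_rev_iff {Γ : Multigraph V A} {e e' : Dart A} :
    Γ.Follows (rev e') (rev e) ↔ Γ.Follows e e' := by
  simp only [Follows, orig_rev, term_rev, rev_rev, ne_eq, eq_comm]

theorem ne_rev_iff {e e' : Dart A} : e' ≠ rev e ↔ (e.1 = e'.1 → e.2 = e'.2) := by
  rcases e with ⟨a, _ | _⟩ <;> rcases e' with ⟨a', _ | _⟩ <;> simp [rev, eq_comm]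

theorem isReduced_iff_freeGroup (l : List (Dart A)) : IsReduced l ↔ FreeGroup.IsReduced l := by
  simp only [IsReduced, FreeGroup.IsReduced, ne_rev_iff]

theorem IsReduced.eq_of_mk_eq {l l' : List (Dart A)} (h : IsReduced l) (h' : IsReduced l')
    (hmk : FreeGroup.mk l = FreeGroup.mk l') : l = l' := by
  classical
  rw [isReduced_iff_freeGroup] at h h'
  rw [← h.reduce_eq, ← h'.reduce_eq]
  exact FreeGroup.reduce.sound hmk

theorem isPath_append_iff {Γ : Multigraph V A} {u v : V} {l l' : List (Dart A)} :
    Γ.IsPath u v (l ++ l') ↔ ∃ w, Γ.IsPath u w l ∧ Γ.IsPath w v l' := by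
  induction l generalizing u with
  | nil => simp [IsPath]
  | cons e l ih => simp [IsPath, ih, and_assoc]

theorem IsPath.end_unique {Γ : Multigraph V A} {u v w : V} {l : List (Dart A)}
    (h : Γ.IsPath u v l) (h' : Γ.IsPath u w l) : v = w := by
  induction l generalizing u with
  | nil => exact h.symm.trans h'
  | cons e l ih => exact ih h.2 h'.2

theorem IsPath.step {Γ : Multigraph V A} {u v : V} {l l' : List (Dart A)}
    (h : Γ.IsPath u v l) (hl : FreeGroup.Red.Step l l') : Γ.IsPath u v l' := by
  obtain ⟨⟩ := hl
  rename_i l₁ l₂ a b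
  obtain ⟨w, h₁, h₂⟩ := isPath_append_iff.1 h
  refine h₁.append ?_
  obtain ⟨ho, ho', h₂⟩ := h₂
  have : Γ.term (a, !b) = Γ.orig (a, b) := Γ.term_rev (a, b)
  rwa [this, ho] at h₂

theorem IsPath.red {Γ : Multigraph V A} {u v : V} {l l' : List (Dart A)}
    (h : Γ.IsPath u v l) (hl : FreeGroup.Red l l') : Γ.IsPath u v l' := by
  induction hl with
  | refl => exact h
  | tail _ hs ih => exact ih.step hs

/-- Every edge-path is homotopic to a reduced one, which is a sublist of it. -/
theorem IsPath.exists_reduced {Γ : Multigraph V A} {u v : V} {l : List (Dart A)}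
    (h : Γ.IsPath u v l) :
    ∃ l', Γ.IsPath u v l' ∧ IsReduced l' ∧ FreeGroup.mk l' = FreeGroup.mk l ∧ l'.Sublist l := by
  classical
  refine ⟨FreeGroup.reduce l, h.red FreeGroup.reduce.red, ?_, FreeGroup.reduce.self,
    FreeGroup.Red.sublist FreeGroup.reduce.red⟩
  rw [isReduced_iff_freeGroup, FreeGroup.isReduced_iff_reduce_eq]
  exact FreeGroup.reduce.idem

theorem IsReduced.tail {e : Dart A} {l : List (Dart A)} (h : IsReduced (e :: l)) :
    IsReduced l := List.IsChain.tail h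

theorem IsPath.isChain_follows {Γ : Multigraph V A} {u v : V} {l : List (Dart A)}
    (h : Γ.IsPath u v l) (hl : IsReduced l) : l.IsChain Γ.Follows := by
  induction l generalizing u with
  | nil => simp
  | cons e l ih =>
    cases l with
    | nil => simp
    | cons e' l =>
      have hl' := List.isChain_cons_cons.1 hl
      exact List.isChain_cons_cons.2 ⟨⟨h.2.1, hl'.1⟩, ih h.2 hl.tail⟩

theorem isReduced_of_isChain_follows {Γ : Multigraph V A} {l : List (Dart A)}
    (h : l.IsChain Γ.Follows) : IsReduced l :=
  h.imp fun _ _ h => h.2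

/-! ### Strong connectedness of the reduced line graph -/

section Irreducible

variable {Γ : Multigraph V A}

theorem one_lt_degree [Finite A] (hdeg : ∀ v, Γ.degree v ≠ 1) (e : Dart A) :
    1 < Γ.degree (Γ.orig e) := by
  have h0 : Γ.degree (Γ.orig e) ≠ 0 := by
    exact Set.ncard_ne_zero_of_mem (a := e) rfl
  have := hdeg (Γ.orig e)
  omega

theorem ncard_follows [Finite A] (e : Dart A) :
    ({e' | Γ.Follows e e'}.ncard : ℝ) = Γ.degree (Γ.term e) - 1 := by
  have h : {e' | Γ.Follows e e'} = {e' | Γ.orig e' = Γ.term e} \ {rev e} := by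
    ext e'; simp [Follows]
  have hm : rev e ∈ {e' | Γ.orig e' = Γ.term e} := by simp
  rw [h, degree, ← Set.ncard_sdiff_singleton_add_one hm]
  simp

theorem ncard_follows' [Finite A] (e' : Dart A) :
    ({e | Γ.Follows e e'}.ncard : ℝ) = Γ.degree (Γ.orig e') - 1 := by
  have h : {e | Γ.Follows e e'} = rev '' {e | Γ.Follows (rev e') e} := by
    ext e
    constructor
    · intro he
      exact ⟨rev e, follows_rev_iff.2 he, rev_rev e⟩
    · rintro ⟨f, hf, rfl⟩
      rw [Set.mem_ofPred_eq, ← follows_rev_iff, rev_rev]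
      exact hf
  rw [h, Set.ncard_image_of_injective _ rev_injective, ncard_follows, term_rev]

/-- The weights `1 / (deg - 1)` on the pairs of consecutive edges form a doubly stochastic matrix,
so a set of oriented edges that is closed under successors is closed under predecessors. -/
theorem mem_of_follows_of_closed [Finite A] (hdeg : ∀ v, Γ.degree v ≠ 1) {R : Set (Dart A)}
    (hR : ∀ e ∈ R, ∀ e', Γ.Follows e e' → e' ∈ R) {e e' : Dart A} (h : Γ.Follows e e')
    (he' : e' ∈ R) : e ∈ R := by
  classical
  have := Fintype.ofFinite A
  let P : Dart A → Dart A → ℝ := fun e e' =>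
    if Γ.Follows e e' then ((Γ.degree (Γ.orig e') : ℝ) - 1)⁻¹ else 0
  have hpos : ∀ e : Dart A, 0 < (Γ.degree (Γ.orig e) : ℝ) - 1 := fun e => by
    have : (1 : ℝ) < Γ.degree (Γ.orig e) := by exact_mod_cast one_lt_degree hdeg e
    linarith
  have hP0 : ∀ e e', 0 ≤ P e e' := fun e e' => by
    simp only [P]; split_ifs
    · exact (inv_pos.2 (hpos e')).le
    · exact le_rfl
  have hrow : ∀ e, ∑ e', P e e' = 1 := fun e => by
    have h1 : ∀ e', P e e' = if Γ.Follows e e' then ((Γ.degree (Γ.term e) : ℝ) - 1)⁻¹ else 0 := by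
      intro e'
      simp only [P]
      split_ifs with hf
      · rw [hf.1]
      · rfl
    have hp := hpos (rev e)
    rw [orig_rev] at hp
    rw [Finset.sum_congr rfl fun e' _ => h1 e', ← Finset.sum_filter, Finset.sum_const,
      nsmul_eq_mul, ← Set.ncard_coe_finset, Finset.coe_filter]
    simp only [Finset.mem_univ, true_and]
    rw [ncard_follows, mul_inv_cancel₀ hp.ne']
  have hcol : ∀ e', ∑ e, P e e' = 1 := fun e' => by
    rw [← Finset.sum_filter, Finset.sum_const,
      nsmul_eq_mul, ← Set.ncard_coe_finset, Finset.coe_filter]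
    simp only [Finset.mem_univ, true_and]
    rw [ncard_follows', mul_inv_cancel₀ (hpos e').ne']
  let S : Finset (Dart A) := Finset.univ.filter (· ∈ R)
  -- By the row sums the total weight from `R` to `R` is `|R|`; by the column sums this is already
  -- the total weight of all pairs ending in `R`, so no such pair starts outside `R`.
  have h1 : ∑ e ∈ S, ∑ e' ∈ S, P e e' = S.card := by
    rw [Finset.sum_congr rfl fun e he => ?_, Finset.sum_const, nsmul_one]
    rw [← hrow e]
    refine Finset.sum_subset (Finset.subset_univ _) fun e' _ he' => if_neg fun hf => he' ?_
    simp only [S, Finset.mem_filter, Finset.mem_univ, true_and] at he ⊢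
    exact hR e he e' hf
  have h2 : ∑ e, ∑ e' ∈ S, P e e' = S.card := by
    rw [Finset.sum_comm, Finset.sum_congr rfl fun e _ => hcol e, Finset.sum_const, nsmul_one]
  by_contra he
  have h3 : ∑ e ∈ S, ∑ e' ∈ S, P e e' < ∑ e, ∑ e' ∈ S, P e e' := by
    refine Finset.sum_lt_sum_of_subset (Finset.subset_univ _) (Finset.mem_univ e)
      (by simpa [S] using he) ?_ fun e _ _ => Finset.sum_nonneg fun e' _ => hP0 e e'
    refine Finset.sum_pos' (fun e' _ => hP0 e e') ⟨e', by simpa [S] using he', ?_⟩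
    simpa [P, h] using hpos e'
  linarith

theorem reflTransGen_follows_symm [Finite A] (hdeg : ∀ v, Γ.degree v ≠ 1) {e e' : Dart A}
    (h : Relation.ReflTransGen Γ.Follows e e') : Relation.ReflTransGen Γ.Follows e' e := by
  induction h with
  | refl => exact .refl
  | tail _ hf ih =>
    exact .trans (mem_of_follows_of_closed hdeg (R := {f | Relation.ReflTransGen Γ.Follows _ f})
      (fun f h f' hf => .tail h hf) hf .refl) ih

theorem reflTransGen_follows_rev {e e' : Dart A}
    (h : Relation.ReflTransGen Γ.Follows e e') :
    Relation.ReflTransGen Γ.Follows (rev e') (rev e) := by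
  induction h with
  | refl => exact .refl
  | tail _ hf ih => exact .head (follows_rev_iff.2 hf) ih

/-- A set of oriented edges that is closed under inverses and successors is empty or everything. -/
theorem mem_of_closed (hconn : Γ.IsConnected) {D : Set (Dart A)}
    (hrev : ∀ e ∈ D, rev e ∈ D) (hD : ∀ e ∈ D, ∀ e', Γ.Follows e e' → e' ∈ D) {e₀ : Dart A}
    (he₀ : e₀ ∈ D) (e : Dart A) : e ∈ D := by
  have key : ∀ l u v, Γ.IsPath u v l → (∀ f, Γ.orig f = u → f ∈ D) →
      ∀ f, Γ.orig f = v → f ∈ D := by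
    intro l
    induction l with
    | nil => rintro u v rfl h; exact h
    | cons e l ih =>
      intro u v h hu
      refine ih _ _ h.2 fun f hf => ?_
      by_cases hfe : f = rev e
      · exact hfe ▸ hrev _ (hu e h.1)
      · exact hD e (hu e h.1) f ⟨hf, hfe⟩
  obtain ⟨l, hl⟩ := hconn (Γ.orig e₀) (Γ.orig e)
  refine key l _ _ hl (fun f hf => ?_) e rfl
  by_cases hfe : f = e₀
  · exact hfe ▸ he₀
  -- The other edges with the origin of `e₀` are the successors of the inverse of `e₀`.
  · exact hD (rev e₀) (hrev _ he₀) f ⟨by rw [hf, term_rev], by rwa [rev_rev]⟩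

/-- If no oriented edge is connected to its inverse in the line graph, then the edges can be
oriented so that every reduced path follows the orientation or runs against it, and the signed
number of edges embeds `π₁` into `ℤ`. -/
theorem exists_reflTransGen_rev [Finite A] (hconn : Γ.IsConnected)
    (hdeg : ∀ v, Γ.degree v ≠ 1) (p : V) (hcomm : ∃ g h : Γ.fundGroup p, g * h ≠ h * g) :
    ∃ f, Relation.ReflTransGen Γ.Follows f (rev f) := by
  classical
  by_contra! hne
  obtain ⟨g, h, hgh⟩ := hcomm
  have word : ∀ g : Γ.fundGroup p, ∃ l, Γ.IsPath p p l ∧ IsReduced l ∧ FreeGroup.mk l = g.1 := by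
    rintro ⟨_, l, hl, rfl⟩
    obtain ⟨l', h1, h2, h3, -⟩ := hl.exists_reduced
    exact ⟨l', h1, h2, h3⟩
  have hg : g ≠ 1 := by rintro rfl; simp at hgh
  obtain ⟨l₀, -, -, hl₀⟩ := word g
  obtain ⟨e₀⟩ : Nonempty (Dart A) := by
    cases l₀ with
    | nil => exact absurd (Subtype.ext hl₀.symm) hg
    | cons e _ => exact ⟨e⟩
  let C : Set (Dart A) := {f | Relation.ReflTransGen Γ.Follows e₀ f}
  have hC : ∀ e ∈ C, ∀ e', Γ.Follows e e' → e' ∈ C := fun e he e' h => he.tail h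
  have hCback : ∀ e e', Γ.Follows e e' → e' ∈ C → e ∈ C := fun e e' h he' =>
    mem_of_follows_of_closed hdeg hC h he'
  have hdisj : ∀ e, e ∈ C → rev e ∉ C := fun e he he' =>
    hne e ((reflTransGen_follows_symm hdeg he).trans he')
  have hall : ∀ e, e ∈ C ∨ rev e ∈ C := by
    refine mem_of_closed hconn (D := {e | e ∈ C ∨ rev e ∈ C}) ?_ ?_ (e₀ := e₀)
      (Or.inl Relation.ReflTransGen.refl)
    · rintro e (he | he)
      · exact Or.inr (by rwa [rev_rev])
      · exact Or.inl he
    · rintro e (he | he) e' h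
      · exact Or.inl (hC e he e' h)
      · exact Or.inr (hCback _ _ (follows_rev_iff.2 h) he)
  -- `C` and its inverse are disjoint and exhaust the edges, so `C` is an orientation of `Γ`.
  let sgn : A → Multiplicative ℤ := fun a => Multiplicative.ofAdd (if (a, true) ∈ C then 1 else -1)
  let φ : FreeGroup A →* Multiplicative ℤ := FreeGroup.lift sgn
  have hφ1 : ∀ e : Dart A, φ (FreeGroup.mk [e]) =
      Multiplicative.ofAdd (if e ∈ C then 1 else -1) := by
    rintro ⟨a, _ | _⟩
    · have h1 : ((a, false) ∈ C) ↔ ¬ (a, true) ∈ C :=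
        ⟨fun h h' => hdisj _ h h', fun h => (hall (a, true)).resolve_left h⟩
      simp only [φ, FreeGroup.lift_mk, sgn, h1]
      by_cases h : (a, true) ∈ C <;> simp [h, ← ofAdd_neg]
    · simp [φ, FreeGroup.lift_mk, sgn]
  have hφ : ∀ (c : Prop) [Decidable c] (l : List (Dart A)), (∀ e ∈ l, e ∈ C ↔ c) →
      φ (FreeGroup.mk l) = Multiplicative.ofAdd ((if c then 1 else -1) * (l.length : ℤ)) := by
    intro c _ l
    induction l with
    | nil => intro _; simp [← FreeGroup.one_eq_mk]
    | cons e l ih =>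
      intro hl
      have h1 : FreeGroup.mk (e :: l) = FreeGroup.mk [e] * FreeGroup.mk l := by
        rw [FreeGroup.mul_mk]; rfl
      rw [h1, map_mul, hφ1, ih fun e' he' => hl e' (List.mem_cons_of_mem _ he'), ← ofAdd_add]
      have h2 := hl e List.mem_cons_self
      simp only [h2, List.length_cons]
      congr 1
      push_cast
      ring
  have hker : ∀ g : Γ.fundGroup p, φ g.1 = 1 → g = 1 := by
    intro g hg1
    obtain ⟨l, hp, hr, hl⟩ := word g
    have hch := hp.isChain_follows hr
    cases l with
    | nil => exact Subtype.ext hl.symm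
    | cons e l =>
      exfalso
      have hmem : ∀ e' ∈ e :: l, e' ∈ C ↔ e ∈ C := by
        clear hl hp hr
        induction l generalizing e with
        | nil => simp
        | cons e₁ l ih =>
          have hch' := List.isChain_cons_cons.1 hch
          have h01 : e₁ ∈ C ↔ e ∈ C := ⟨hCback _ _ hch'.1, fun h => hC _ h _ hch'.1⟩
          intro e' he'
          rcases List.mem_cons.1 he' with rfl | he'
          · rfl
          · exact (ih e₁ hch'.2 e' he').trans h01
      have := hφ _ _ hmem
      rw [hl, hg1] at this
      have h2 : (0 : ℤ) = (if e ∈ C then 1 else -1) * (((e :: l).length : ℕ) : ℤ) := this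
      simp only [List.length_cons] at h2
      push_cast at h2
      split_ifs at h2 <;> omega
  apply hgh
  have h1 := hker (g * h * (h * g)⁻¹) (by
    simp only [Subgroup.coe_mul, Subgroup.coe_inv, map_mul, map_inv]
    rw [mul_comm (φ h.1) (φ g.1), mul_inv_cancel])
  exact mul_inv_eq_one.1 h1

/-- The reduced line graph is strongly connected. -/
theorem reflTransGen_follows [Finite A] (hconn : Γ.IsConnected)
    (hdeg : ∀ v, Γ.degree v ≠ 1) (p : V) (hcomm : ∃ g h : Γ.fundGroup p, g * h ≠ h * g)
    (e e' : Dart A) :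
    Relation.ReflTransGen Γ.Follows e e' := by
  obtain ⟨f, hf⟩ := exists_reflTransGen_rev hconn hdeg p hcomm
  have key : ∀ e, Relation.ReflTransGen Γ.Follows f e := by
    refine mem_of_closed hconn (D := {e | Relation.ReflTransGen Γ.Follows f e}) ?_ ?_ (e₀ := f)
      Relation.ReflTransGen.refl
    · intro e he
      exact hf.trans (reflTransGen_follows_symm hdeg (reflTransGen_follows_rev he))
    · exact fun e he e' h => he.tail h
  exact (reflTransGen_follows_symm hdeg (key e)).trans (key e')

end Irreducible

/-- A group isomorphic to a free group of rank at least two is not commutative. -/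
theorem exists_mul_ne_mul_of_freeGroup {G : Type*} [Group G] {k : ℕ} (hk : 2 ≤ k)
    (α : FreeGroup (Fin k) ≃* G) : ∃ g h : G, g * h ≠ h * g := by
  refine ⟨α (.of ⟨0, by omega⟩), α (.of ⟨1, by omega⟩), fun h => ?_⟩
  rw [← map_mul, ← map_mul] at h
  have := congrArg FreeGroup.toWord (α.injective h)
  simp [FreeGroup.toWord_mul, FreeGroup.reduce] at this

/-! ### Positive fixed vectors of the weighted line graph -/

section Perron

variable {Γ : Multigraph V A}

theorem lineMatrix_nonneg (e e' : Dart A) : 0 ≤ Γ.lineMatrix e e' := by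
  unfold lineMatrix; split_ifs <;> simp

theorem lineMatrix_of_follows {e e' : Dart A} (h : Γ.Follows e e') : Γ.lineMatrix e e' = 1 :=
  if_pos h

variable [Fintype A]

/-- The vector `y` is fixed by the matrix with entries `exp (-s L(e)) m e e'`. -/
def IsFixedVector (Γ : Multigraph V A) (L : Dart A → ℝ) (s : ℝ) (y : Dart A → ℝ) : Prop :=
  ∀ e, Real.exp (-s * L e) * ∑ e', Γ.lineMatrix e e' * y e' = y e

theorem isFixedVector_of_sysFun {L y : Dart A → ℝ} {s : ℝ} (h : ∀ i, Γ.sysFun L y s i = 0) :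
    Γ.IsFixedVector L s y := fun e => sub_eq_zero.1 (h (Sum.inl e))

theorem IsFixedVector.pos {L w : Dart A → ℝ} {σ : ℝ} (h : Γ.IsFixedVector L σ w)
    (hirr : ∀ e e', Relation.ReflTransGen Γ.Follows e e') (hw : ∀ e, 0 ≤ w e)
    {e₀ : Dart A} (h₀ : w e₀ ≠ 0) (e : Dart A) : 0 < w e := by
  induction hirr e e₀ using Relation.ReflTransGen.head_induction_on with
  | refl => exact (hw _).lt_of_ne h₀.symm
  | @head a b hf _ ih =>
    rw [← h]
    refine mul_pos (Real.exp_pos _) (Finset.sum_pos'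
      (fun e' _ => mul_nonneg (lineMatrix_nonneg _ _) (hw e')) ⟨b, Finset.mem_univ _, ?_⟩)
    rw [lineMatrix_of_follows hf, one_mul]
    exact ih

/-- A matrix with a positive fixed vector has a left fixed vector; its absolute value is again
fixed, as one sees by pairing with the positive fixed vector, and it is positive by
irreducibility. -/
theorem IsFixedVector.exists_left {L y : Dart A → ℝ} {s : ℝ} (h : Γ.IsFixedVector L s y)
    (hirr : ∀ e e', Relation.ReflTransGen Γ.Follows e e') (hy : ∀ e, 0 < y e)
    [Nonempty (Dart A)] :
    ∃ u : Dart A → ℝ, (∀ e, 0 < u e) ∧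
      ∀ e', ∑ e, u e * (Real.exp (-s * L e) * Γ.lineMatrix e e') = u e' := by
  classical
  let B : Matrix (Dart A) (Dart A) ℝ := fun e e' => Real.exp (-s * L e) * Γ.lineMatrix e e'
  have hB0 : ∀ e e', 0 ≤ B e e' := fun e e' =>
    mul_nonneg (Real.exp_pos _).le (lineMatrix_nonneg _ _)
  have hBy : ∀ e, ∑ e', B e e' * y e' = y e := fun e => by
    rw [← h e, Finset.mul_sum]
    exact Finset.sum_congr rfl fun e' _ => mul_assoc _ _ _
  have hdet : (B - 1).det = 0 := by
    refine Matrix.exists_mulVec_eq_zero_iff.1 ⟨y, fun hy0 => ?_, ?_⟩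
    · obtain ⟨e⟩ := ‹Nonempty (Dart A)›
      exact (hy e).ne' (congrFun hy0 e)
    · rw [Matrix.sub_mulVec, Matrix.one_mulVec, sub_eq_zero]
      exact funext hBy
  obtain ⟨v, hv0, hv⟩ := Matrix.exists_vecMul_eq_zero_iff.2 hdet
  rw [Matrix.vecMul_sub, Matrix.vecMul_one, sub_eq_zero] at hv
  have hle : ∀ e', |v e'| ≤ ∑ e, |v e| * B e e' := fun e' => by
    calc |v e'| = |∑ e, v e * B e e'| := by rw [← congrFun hv e']; rfl
      _ ≤ ∑ e, |v e * B e e'| := Finset.abs_sum_le_sum_abs _ _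
      _ = ∑ e, |v e| * B e e' :=
        Finset.sum_congr rfl fun e _ => by rw [abs_mul, abs_of_nonneg (hB0 e e')]
  have hsum : ∑ e', (∑ e, |v e| * B e e' - |v e'|) * y e' = 0 := by
    simp_rw [sub_mul, Finset.sum_sub_distrib, Finset.sum_mul]
    rw [Finset.sum_comm, sub_eq_zero]
    refine Finset.sum_congr rfl fun e _ => ?_
    simp_rw [mul_assoc]
    rw [← Finset.mul_sum, hBy]
  have heq : ∀ e', ∑ e, |v e| * B e e' = |v e'| := fun e' => by
    have := (Finset.sum_eq_zero_iff_of_nonneg fun e' _ =>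
      mul_nonneg (sub_nonneg.2 (hle e')) (hy e').le).1 hsum e' (Finset.mem_univ _)
    exact sub_eq_zero.1 ((mul_eq_zero.1 this).resolve_right (hy e').ne')
  refine ⟨fun e => |v e|, fun e => ?_, heq⟩
  obtain ⟨e₀, he₀⟩ := Function.ne_iff.1 hv0
  have hpos : 0 < |v e₀| := abs_pos.2 he₀
  induction hirr e₀ e with
  | refl => exact hpos
  | tail _ hf ih =>
    beta_reduce
    rw [← heq]
    refine Finset.sum_pos' (fun e _ => mul_nonneg (abs_nonneg _) (hB0 _ _))
      ⟨_, Finset.mem_univ _, mul_pos ih ?_⟩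
    simp only [B, lineMatrix_of_follows hf, mul_one]
    exact Real.exp_pos _

/-- The pairing of `w` with the left fixed vector for the exponent `s` is strictly monotone in the
exponent of `w`, so that both exponents agree. -/
theorem IsFixedVector.exponent_unique {L y w : Dart A → ℝ} {s σ : ℝ}
    (h : Γ.IsFixedVector L s y) (hw : Γ.IsFixedVector L σ w)
    (hirr : ∀ e e', Relation.ReflTransGen Γ.Follows e e') (hy : ∀ e, 0 < y e)
    (hwpos : ∀ e, 0 < w e) (hL : ∀ e, 0 ≤ L e) {e₁ : Dart A} (he₁ : 0 < L e₁) : σ = s := by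
  have : Nonempty (Dart A) := ⟨e₁⟩
  obtain ⟨u, hu, huB⟩ := h.exists_left hirr hy
  let W : Dart A → ℝ := fun e => ∑ e', Γ.lineMatrix e e' * w e'
  have hW : ∀ e, 0 < W e := fun e => by
    have h1 := hwpos e
    rw [← hw e] at h1
    exact pos_of_mul_pos_right h1 (Real.exp_pos _).le
  have h1 : ∑ e, u e * (Real.exp (-σ * L e) * W e) = ∑ e, u e * w e :=
    Finset.sum_congr rfl fun e _ => by rw [hw e]
  have h2 : ∑ e, u e * (Real.exp (-s * L e) * W e) = ∑ e, u e * w e := by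
    simp only [W, Finset.mul_sum]
    rw [Finset.sum_comm]
    refine Finset.sum_congr rfl fun e' _ => ?_
    conv_rhs => rw [← huB e', Finset.sum_mul]
    exact Finset.sum_congr rfl fun e _ => by ring
  have key : ∀ a b : ℝ, a < b →
      ∑ e, u e * (Real.exp (-b * L e) * W e) < ∑ e, u e * (Real.exp (-a * L e) * W e) := by
    intro a b hab
    refine Finset.sum_lt_sum (fun e _ => ?_) ⟨e₁, Finset.mem_univ _, ?_⟩
    · refine mul_le_mul_of_nonneg_left (mul_le_mul_of_nonneg_right
        (Real.exp_le_exp.2 ?_) (hW e).le) (hu e).le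
      nlinarith [hL e]
    · refine mul_lt_mul_of_pos_left (mul_lt_mul_of_pos_right
        (Real.exp_lt_exp.2 ?_) (hW e₁)) (hu e₁)
      nlinarith
  rcases lt_trichotomy σ s with hlt | heq | hgt
  · linarith [key _ _ hlt]
  · exact heq
  · linarith [key _ _ hgt]

/-- Subtracting the largest multiple of `w` that stays below `y` leaves a nonnegative fixed vector
with a zero entry, which must vanish. -/
theorem IsFixedVector.exists_eq_mul {L y w : Dart A → ℝ} {s : ℝ}
    (h : Γ.IsFixedVector L s y) (hw : Γ.IsFixedVector L s w)
    (hirr : ∀ e e', Relation.ReflTransGen Γ.Follows e e') (hwpos : ∀ e, 0 < w e) :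
    ∃ c : ℝ, ∀ e, y e = c * w e := by
  rcases isEmpty_or_nonempty (Dart A) with _ | _
  · exact ⟨0, fun e => isEmptyElim e⟩
  obtain ⟨e₁, he₁⟩ := Finite.exists_min fun e => y e / w e
  refine ⟨y e₁ / w e₁, fun e => ?_⟩
  by_contra hne
  have hz : Γ.IsFixedVector L s fun e => y e - y e₁ / w e₁ * w e := fun e => by
    beta_reduce
    conv_rhs => rw [← h e, ← hw e]
    simp only [mul_sub, Finset.sum_sub_distrib, Finset.mul_sum]
    congr 1
    exact Finset.sum_congr rfl fun e _ => by ring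
  have hpos := hz.pos hirr (fun e => ?_) (e₀ := e) (sub_ne_zero.2 hne) e₁
  · simp [(hwpos e₁).ne'] at hpos
  · exact sub_nonneg.2 ((le_div_iff₀ (hwpos e)).1 (he₁ e))

end Perron

/-! ### The Jacobian -/

section Jacobian

variable [Fintype A] {Γ : Multigraph V A}

/-- The functions of the system, as a map of the lengths and of the joint vector of the unknowns
`y` and `s`. -/
noncomputable def sysMap (Γ : Multigraph V A) (v : (Dart A → ℝ) × (Dart A ⊕ Unit → ℝ)) :
    Dart A ⊕ Unit → ℝ :=
  Γ.sysFun v.1 (fun e => v.2 (Sum.inl e)) (v.2 (Sum.inr ()))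

theorem contDiff_sysMap (n : WithTop ℕ∞) : ContDiff ℝ n (Γ.sysMap) := by
  rw [contDiff_pi]
  rintro (e | _)
  · simp only [sysMap, sysFun]
    fun_prop
  · simp only [sysMap, sysFun]
    fun_prop

theorem jacobian_eq_fderiv [DecidableEq A] (v : (Dart A → ℝ) × (Dart A ⊕ Unit → ℝ))
    (i j : Dart A ⊕ Unit) :
    Γ.jacobian v.1 (fun e => v.2 (Sum.inl e)) (v.2 (Sum.inr ())) i j =
      (fderiv ℝ Γ.sysMap v).comp (ContinuousLinearMap.inr ℝ _ _) (Pi.single j 1) i := by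
  have hF : HasFDerivAt Γ.sysMap (fderiv ℝ Γ.sysMap v) v :=
    ((contDiff_sysMap (Γ := Γ) 1).differentiable one_ne_zero v).hasFDerivAt
  have h1 : HasDerivAt (fun t : ℝ => (v.1, Function.update v.2 j t))
      ((0, Pi.single j 1) : (Dart A → ℝ) × (Dart A ⊕ Unit → ℝ)) (v.2 j) :=
    (hasDerivAt_const _ _).prodMk (hasDerivAt_update v.2 j (v.2 j))
  have h2 : HasDerivAt (fun t => Γ.sysMap (v.1, Function.update v.2 j t))
      (fderiv ℝ Γ.sysMap v (0, Pi.single j 1)) (v.2 j) := by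
    refine HasFDerivAt.comp_hasDerivAt (l := Γ.sysMap) (l' := fderiv ℝ Γ.sysMap v) (v.2 j) ?_ h1
    simpa using hF
  have h3 := ((hasDerivAt_pi.1 h2) i).deriv
  rw [ContinuousLinearMap.comp_apply, ContinuousLinearMap.inr_apply, ← h3]
  rcases j with e | _
  · simp only [jacobian, sysMap]
    congr 1
    funext t
    congr 1
    funext e'
    by_cases h : e' = e
    · subst h; simp
    · simp [h]
  · simp [jacobian, sysMap]

theorem jacobian_inl_inl [DecidableEq A] (L y : Dart A → ℝ) (s : ℝ) (e e' : Dart A) :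
    Γ.jacobian L y s (Sum.inl e) (Sum.inl e') =
      Real.exp (-s * L e) * Γ.lineMatrix e e' - if e = e' then 1 else 0 := by
  have hu : ∀ f, HasDerivAt (fun t => Function.update y e' t f) (if f = e' then 1 else 0)
      (y e') := fun f => by
    have := hasDerivAt_pi.1 (hasDerivAt_update y e' (y e')) f
    simpa [Pi.single_apply] using this
  have := ((HasDerivAt.fun_sum fun f (_ : f ∈ Finset.univ) =>
    (hu f).const_mul (Γ.lineMatrix e f)).const_mul (Real.exp (-s * L e))).sub (hu e)
  simp only [jacobian, sysFun]
  refine (this.deriv).trans ?_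
  simp

theorem jacobian_inl_inr [DecidableEq A] (L y : Dart A → ℝ) (s : ℝ) (e : Dart A) (x : Unit) :
    Γ.jacobian L y s (Sum.inl e) (Sum.inr x) =
      -(L e * (Real.exp (-s * L e) * ∑ e', Γ.lineMatrix e e' * y e')) := by
  have := ((((hasDerivAt_id s).neg.mul_const (L e)).exp).mul_const
    (∑ e', Γ.lineMatrix e e' * y e')).sub_const (y e)
  simp only [jacobian, sysFun]
  refine (this.deriv).trans ?_
  simp
  ring

theorem jacobian_inr_inl [DecidableEq A] (L y : Dart A → ℝ) (s : ℝ) (e : Dart A) (x : Unit) :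
    Γ.jacobian L y s (Sum.inr x) (Sum.inl e) = 2 * y e := by
  have hu : ∀ f, HasDerivAt (fun t => Function.update y e t f) (if f = e then 1 else 0)
      (y e) := fun f => by
    have := hasDerivAt_pi.1 (hasDerivAt_update y e (y e)) f
    simpa [Pi.single_apply] using this
  have := (HasDerivAt.fun_sum fun f (_ : f ∈ Finset.univ) => (hu f).pow 2).sub_const 1
  simp only [jacobian, sysFun]
  refine (this.deriv).trans ?_
  simp

theorem jacobian_inr_inr [DecidableEq A] (L y : Dart A → ℝ) (s : ℝ) (x x' : Unit) :
    Γ.jacobian L y s (Sum.inr x) (Sum.inr x') = 0 := by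
  simp [jacobian, sysFun]

/-- A vector `(v, t)` in the kernel of the Jacobian satisfies `(B - 1) v = t (L(e) y_e)_e`; pairing
with the positive left fixed vector of `B` gives `t = 0`, so that `v` is a multiple of `y`, and it
is orthogonal to `y`. -/
theorem det_jacobian_ne_zero [DecidableEq A] {L y : Dart A → ℝ} {s : ℝ}
    (hirr : ∀ e e', Relation.ReflTransGen Γ.Follows e e')
    (hsys : ∀ i, Γ.sysFun L y s i = 0) (hy : ∀ e, 0 < y e)
    (hL : ∀ e, 0 ≤ L e) {e₁ : Dart A} (he₁ : 0 < L e₁) : (Γ.jacobian L y s).det ≠ 0 := by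
  have : Nonempty (Dart A) := ⟨e₁⟩
  have h := isFixedVector_of_sysFun hsys
  obtain ⟨u, hu, huB⟩ := h.exists_left hirr hy
  intro hdet
  obtain ⟨v, hv0, hv⟩ := Matrix.exists_mulVec_eq_zero_iff.2 hdet
  have hrow : ∀ e, Real.exp (-s * L e) * ∑ e', Γ.lineMatrix e e' * v (Sum.inl e') - v (Sum.inl e)
      = v (Sum.inr ()) * (L e * y e) := fun e => by
    have h1 := congrFun hv (Sum.inl e)
    simp only [Matrix.mulVec, dotProduct, Fintype.sum_sum_type, jacobian_inl_inl,
      jacobian_inl_inr, sub_mul, Finset.sum_sub_distrib, h e, Finset.univ_unique,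
      Finset.sum_singleton, ite_mul, one_mul, zero_mul, Finset.sum_ite_eq, Finset.mem_univ, if_true,
      Pi.zero_apply] at h1
    rw [Finset.mul_sum]
    simp only [← mul_assoc]
    simp only [mul_assoc] at h1 ⊢
    have h2 : v (Sum.inr PUnit.unit) = v (Sum.inr ()) := rfl
    linarith
  have horth : ∑ e, y e * v (Sum.inl e) = 0 := by
    have h1 := congrFun hv (Sum.inr ())
    simp only [Matrix.mulVec, dotProduct, Fintype.sum_sum_type, jacobian_inr_inl,
      jacobian_inr_inr, Finset.univ_unique, Finset.sum_singleton, zero_mul, add_zero,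
      Pi.zero_apply, mul_assoc, ← Finset.mul_sum] at h1
    linarith
  have ht : v (Sum.inr ()) = 0 := by
    have h1 : ∑ e, u e * (Real.exp (-s * L e) * ∑ e', Γ.lineMatrix e e' * v (Sum.inl e')) =
        ∑ e, u e * v (Sum.inl e) := by
      simp only [Finset.mul_sum]
      rw [Finset.sum_comm]
      refine Finset.sum_congr rfl fun e' _ => ?_
      conv_rhs => rw [← huB e', Finset.sum_mul]
      exact Finset.sum_congr rfl fun e _ => by ring
    have h2 : v (Sum.inr ()) * ∑ e, u e * (L e * y e) = 0 := by
      rw [Finset.mul_sum, ← sub_eq_zero.2 h1, ← Finset.sum_sub_distrib]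
      refine Finset.sum_congr rfl fun e _ => ?_
      rw [← mul_sub, hrow]
      ring
    refine (mul_eq_zero.1 h2).resolve_right (ne_of_gt ?_)
    exact Finset.sum_pos' (fun e _ => mul_nonneg (hu e).le (mul_nonneg (hL e) (hy e).le))
      ⟨e₁, Finset.mem_univ _, mul_pos (hu _) (mul_pos he₁ (hy _))⟩
  have hvfix : Γ.IsFixedVector L s fun e => v (Sum.inl e) := fun e => by
    have := hrow e
    rw [ht, zero_mul] at this
    exact sub_eq_zero.1 this
  obtain ⟨c, hc⟩ := hvfix.exists_eq_mul h hirr hy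
  have hy2 : ∑ e, y e ^ 2 = 1 := sub_eq_zero.1 (hsys (Sum.inr ()))
  have hc0 : c = 0 := by
    calc c = c * ∑ e, y e ^ 2 := by rw [hy2, mul_one]
      _ = ∑ e, y e * v (Sum.inl e) := by
        rw [Finset.mul_sum]
        exact Finset.sum_congr rfl fun e _ => by rw [hc e]; ring
      _ = 0 := horth
  apply hv0
  funext i
  rcases i with e | _
  · rw [hc e, hc0, zero_mul]; rfl
  · exact ht

open scoped ContDiff in
/-- The analytic implicit function theorem for the system. -/
theorem exists_analytic_solution [DecidableEq A] {L₀ y₀ : Dart A → ℝ} {s₀ : ℝ}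
    (hsys : ∀ i, Γ.sysFun L₀ y₀ s₀ i = 0) (hs₀ : 0 < s₀) (hy₀ : ∀ e, 0 < y₀ e)
    (hdet : (Γ.jacobian L₀ y₀ s₀).det ≠ 0) :
    ∃ (U : Set (Dart A → ℝ)) (s : (Dart A → ℝ) → ℝ) (y : (Dart A → ℝ) → Dart A → ℝ),
      IsOpen U ∧ L₀ ∈ U ∧ AnalyticOnNhd ℝ s U ∧ (∀ e, AnalyticOnNhd ℝ (fun L => y L e) U) ∧
      s L₀ = s₀ ∧ y L₀ = y₀ ∧ (∀ L ∈ U, ∀ i, Γ.sysFun L (y L) (s L) i = 0) ∧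
      ∀ L ∈ U, 0 < s L ∧ ∀ e, 0 < y L e := by
  let v : (Dart A → ℝ) × (Dart A ⊕ Unit → ℝ) := (L₀, Sum.elim y₀ fun _ => s₀)
  let J := (fderiv ℝ Γ.sysMap v).comp (ContinuousLinearMap.inr ℝ (Dart A → ℝ) (Dart A ⊕ Unit → ℝ))
  have hJ : ∀ w, J w = (Γ.jacobian L₀ y₀ s₀).mulVec w := by
    intro w
    have h1 : LinearMap.toMatrix' J.toLinearMap = Γ.jacobian L₀ y₀ s₀ := by
      ext i j
      rw [LinearMap.toMatrix'_apply]
      exact (jacobian_eq_fderiv v i j).symm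
    rw [← h1, LinearMap.toMatrix'_mulVec]
    rfl
  have hinv : J.IsInvertible := by
    have hinj : Function.Injective J.toLinearMap := by
      refine (injective_iff_map_eq_zero _).2 fun w hw => ?_
      by_contra hw0
      exact hdet (Matrix.exists_mulVec_eq_zero_iff.1 ⟨w, hw0, by rw [← hJ]; exact hw⟩)
    exact ⟨(LinearEquiv.ofInjectiveEndo J.toLinearMap hinj).toContinuousLinearEquiv, by
      ext; rfl⟩
  have hcd : ContDiffAt ℝ ω Γ.sysMap v := (contDiff_sysMap ω).contDiffAt
  have hω : (ω : WithTop ℕ∞) ≠ 0 := by simp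
  let ψ := hcd.implicitFunction hω hinv
  have hψ : AnalyticAt ℝ ψ L₀ := (hcd.contDiffAt_implicitFunction hω hinv).analyticAt
  have hψ0 : ψ L₀ = Sum.elim y₀ fun _ => s₀ := hcd.implicitFunction_apply_self hω hinv
  have hv0 : Γ.sysMap v = 0 := funext hsys
  have hpos : ∀ i, ∀ᶠ L in 𝓝 L₀, 0 < ψ L i := fun i => by
    have hc : ContinuousAt (fun L => ψ L i) L₀ := (continuousAt_pi.1 hψ.continuousAt) i
    refine hc.eventually (lt_mem_nhds ?_)
    beta_reduce
    rw [hψ0]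
    rcases i with e | _
    · exact hy₀ e
    · exact hs₀
  have hev := (hcd.eventually_apply_implicitFunction hω hinv).and
    (hψ.eventually_analyticAt.and (eventually_all.2 hpos))
  obtain ⟨U, hU, hUo, hLU⟩ := eventually_nhds_iff.1 hev
  refine ⟨U, fun L => ψ L (Sum.inr ()), fun L e => ψ L (Sum.inl e), hUo, hLU, ?_, ?_, ?_, ?_, ?_,
    ?_⟩
  · exact fun L hL => analyticAt_pi_iff.1 (hU L hL).2.1 _
  · exact fun e L hL => analyticAt_pi_iff.1 (hU L hL).2.1 _
  · simp only [hψ0]; rfl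
  · simp only [hψ0]; rfl
  · intro L hL i
    have h1 := (hU L hL).1
    rw [hv0] at h1
    exact congrFun h1 i
  · exact fun L hL => ⟨(hU L hL).2.2 _, fun e => (hU L hL).2.2 _⟩

end Jacobian

/-! ### The universal cover is a tree -/

section Cover

variable {Γ : Multigraph V A} {p : V} {L : Dart A → ℝ}

theorem orig_cover_snd (f : Dart (Γ.CoverEdge p)) :
    ((Γ.cover p).orig f).1.2 = Γ.orig (Γ.proj p f) := by
  rcases f with ⟨z, _ | _⟩
  · rfl
  · exact z.2

theorem term_cover_snd (f : Dart (Γ.CoverEdge p)) :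
    ((Γ.cover p).term f).1.2 = Γ.term (Γ.proj p f) := by
  rcases f with ⟨z, _ | _⟩
  · exact z.2
  · rfl

theorem term_cover_fst (f : Dart (Γ.CoverEdge p)) :
    ((Γ.cover p).term f).1.1 = ((Γ.cover p).orig f).1.1 * FreeGroup.mk [Γ.proj p f] := by
  rcases f with ⟨z, _ | _⟩
  · change z.1.1.1.1 = z.1.1.1.1 * FreeGroup.of z.1.2 * (FreeGroup.of z.1.2)⁻¹
    rw [mul_inv_cancel_right]
  · rfl

theorem proj_rev (f : Dart (Γ.CoverEdge p)) : Γ.proj p (rev f) = rev (Γ.proj p f) := rfl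

theorem dart_cover_ext {f f' : Dart (Γ.CoverEdge p)}
    (h : (Γ.cover p).orig f = (Γ.cover p).orig f') (h' : Γ.proj p f = Γ.proj p f') : f = f' := by
  have ha : f.1.1.2 = f'.1.1.2 := congrArg (fun e : Dart A => e.1) h'
  have hb : f.2 = f'.2 := congrArg (fun e : Dart A => e.2) h'
  have hx : f.1.1.1 = f'.1.1.1 := by
    obtain ⟨⟨⟨x, a⟩, hz⟩, b⟩ := f
    obtain ⟨⟨⟨x', a'⟩, hz'⟩, b'⟩ := f'
    simp only at ha hb ⊢
    subst ha hb
    rcases b with _ | _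
    · have h1 : x.1.1 * FreeGroup.of a = x'.1.1 * FreeGroup.of a :=
        congrArg (fun x => x.1.1) h
      exact Subtype.ext (Prod.ext (mul_right_cancel h1) (hz.trans hz'.symm))
    · exact h
  exact Prod.ext (Subtype.ext (Prod.ext hx ha)) hb

theorem exists_lift (x : Γ.CoverVertex p) {e : Dart A} (he : Γ.orig e = x.1.2) :
    ∃ f, (Γ.cover p).orig f = x ∧ Γ.proj p f = e := by
  obtain ⟨a, _ | _⟩ := e
  · obtain ⟨⟨g, v⟩, l, hl, hg⟩ := x
    obtain rfl : Γ.tgt a = v := he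
    simp only at hl hg
    refine ⟨(⟨(⟨(g * (FreeGroup.of a)⁻¹, Γ.src a), l ++ [(a, false)],
      hl.append ⟨rfl, rfl⟩, ?_⟩, a), rfl⟩, false), Subtype.ext (Prod.ext ?_ rfl), rfl⟩
    · rw [← FreeGroup.mul_mk, hg]; rfl
    · exact inv_mul_cancel_right g (FreeGroup.of a)
  · exact ⟨(⟨(x, a), he.symm⟩, true), rfl, rfl⟩

theorem follows_cover_iff {f f' : Dart (Γ.CoverEdge p)} : (Γ.cover p).Follows f f' ↔
    (Γ.cover p).orig f' = (Γ.cover p).term f ∧ Γ.Follows (Γ.proj p f) (Γ.proj p f') := by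
  constructor
  · rintro ⟨h, h'⟩
    refine ⟨h, ?_, fun hr => h' (dart_cover_ext (by rw [h, orig_rev]) hr)⟩
    rw [← orig_cover_snd, h, term_cover_snd]
  · rintro ⟨h, h'⟩
    exact ⟨h, fun hr => h'.2 (by rw [hr, proj_rev])⟩

theorem IsPath.map_proj {x z : Γ.CoverVertex p} {l : List (Dart (Γ.CoverEdge p))}
    (h : (Γ.cover p).IsPath x z l) :
    Γ.IsPath x.1.2 z.1.2 (l.map (Γ.proj p)) ∧
      z.1.1 = x.1.1 * FreeGroup.mk (l.map (Γ.proj p)) := by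
  induction l generalizing x with
  | nil =>
    obtain rfl : x = z := h
    exact ⟨rfl, (mul_one _).symm⟩
  | cons f l ih =>
    obtain ⟨rfl, h⟩ := h
    obtain ⟨h1, h2⟩ := ih h
    refine ⟨⟨(orig_cover_snd f).symm, term_cover_snd f ▸ h1⟩, ?_⟩
    rw [h2, term_cover_fst, mul_assoc, FreeGroup.mul_mk]
    rfl

theorem IsPath.isReduced_map_proj {x z : Γ.CoverVertex p} {l : List (Dart (Γ.CoverEdge p))}
    (h : (Γ.cover p).IsPath x z l) (hl : IsReduced l) : IsReduced (l.map (Γ.proj p)) :=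
  isReduced_of_isChain_follows (Γ := Γ) <| (List.isChain_map _).2 <|
    (h.isChain_follows hl).imp fun _ _ h => (follows_cover_iff.1 h).2

theorem isReduced_of_map_proj {l : List (Dart (Γ.CoverEdge p))}
    (h : IsReduced (l.map (Γ.proj p))) : IsReduced l :=
  ((List.isChain_map _).1 h).imp fun f f' h h' => h (by rw [h', proj_rev])

theorem IsPath.exists_lift {x : Γ.CoverVertex p} {u : V} {l : List (Dart A)}
    (h : Γ.IsPath x.1.2 u l) :
    ∃ l' z, (Γ.cover p).IsPath x z l' ∧ l'.map (Γ.proj p) = l := by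
  induction l generalizing x with
  | nil => exact ⟨[], x, rfl, rfl⟩
  | cons e l ih =>
    obtain ⟨f, hf, rfl⟩ := Multigraph.exists_lift x h.1
    have h' := h.2
    rw [← term_cover_snd] at h'
    obtain ⟨l', z, hl', rfl⟩ := ih h'
    exact ⟨f :: l', z, ⟨hf, hl'⟩, rfl⟩

theorem IsPath.eq_of_map_proj_eq {x z z' : Γ.CoverVertex p}
    {l l' : List (Dart (Γ.CoverEdge p))} (h : (Γ.cover p).IsPath x z l)
    (h' : (Γ.cover p).IsPath x z' l') (hl : l.map (Γ.proj p) = l'.map (Γ.proj p)) : l = l' := by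
  induction l generalizing x l' with
  | nil => exact (List.map_eq_nil_iff.1 hl.symm).symm
  | cons f l ih =>
    cases l' with
    | nil => simp at hl
    | cons f' l' =>
      obtain ⟨h1, h2⟩ := List.cons_eq_cons.1 hl
      obtain rfl := dart_cover_ext (h.1.trans h'.1.symm) h1
      rw [ih h.2 h'.2 h2]

theorem IsPath.cover_unique {x z : Γ.CoverVertex p} {l l' : List (Dart (Γ.CoverEdge p))}
    (h : (Γ.cover p).IsPath x z l) (hl : IsReduced l)
    (h' : (Γ.cover p).IsPath x z l') (hl' : IsReduced l') : l = l' :=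
  h.eq_of_map_proj_eq h' <| (h.isReduced_map_proj hl).eq_of_mk_eq (h'.isReduced_map_proj hl') <|
    mul_left_cancel (h.map_proj.2.symm.trans h'.map_proj.2)

theorem treeDist_cover_eq {M : Dart (Γ.CoverEdge p) → ℝ} {x z : Γ.CoverVertex p}
    {l : List (Dart (Γ.CoverEdge p))} (h : (Γ.cover p).IsPath x z l) (hl : IsReduced l) :
    (Γ.cover p).treeDist M x z = pathLength M l := by
  have : {r | ∃ l, (Γ.cover p).IsPath x z l ∧ IsReduced l ∧ pathLength M l = r} =
      {pathLength M l} := by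
    ext r
    constructor
    · rintro ⟨l', h', hl', rfl⟩
      rw [h.cover_unique hl h' hl']; rfl
    · rintro rfl
      exact ⟨l, h, hl, rfl⟩
  rw [treeDist, this, csInf_singleton]

theorem coverDist_eq {x z : Γ.CoverVertex p} {l : List (Dart A)} (h : Γ.IsPath x.1.2 z.1.2 l)
    (hl : IsReduced l) (hz : z.1.1 = x.1.1 * FreeGroup.mk l) :
    Γ.coverDist p L x z = pathLength L l := by
  obtain ⟨l', z', hl', rfl⟩ := h.exists_lift
  obtain rfl : z' = z := Subtype.ext
    (Prod.ext (hl'.map_proj.2.trans hz.symm) (hl'.map_proj.1.end_unique h))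
  rw [coverDist, treeDist_cover_eq hl' (isReduced_of_map_proj hl)]
  simp [pathLength, Function.comp_def]
  rfl

/-- The reduced path joining `x` to its translate by `g`. -/
theorem exists_path_actVertex (g : Γ.fundGroup p) (x : Γ.CoverVertex p) :
    ∃ l, Γ.IsPath x.1.2 x.1.2 l ∧ IsReduced l ∧ FreeGroup.mk l = x.1.1⁻¹ * g.1 * x.1.1 ∧
      Γ.coverDist p L x (Γ.actVertex p g x) = pathLength L l := by
  obtain ⟨lx, hlx, hx⟩ := x.2
  obtain ⟨lg, hlg, hg⟩ := g.2
  obtain ⟨l, hl, hr, hmk, -⟩ := ((hlx.invRev.append hlg).append hlx).exists_reduced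
  have h1 : FreeGroup.mk l = x.1.1⁻¹ * g.1 * x.1.1 := by
    rw [hmk, ← FreeGroup.mul_mk, ← FreeGroup.mul_mk, ← FreeGroup.inv_mk, hx, hg]
  refine ⟨l, hl, hr, h1, coverDist_eq hl hr ?_⟩
  rw [h1]
  simp [actVertex, mul_assoc]

end Cover

/-! ### Sums over reduced paths -/

section PathSums

variable {Γ : Multigraph V A} {L : Dart A → ℝ}

@[simp] theorem pathLength_cons (L : Dart A → ℝ) (e : Dart A) (l : List (Dart A)) :
    pathLength L (e :: l) = L e + pathLength L l := by
  simp [pathLength]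

@[simp] theorem pathLength_append (L : Dart A → ℝ) (l l' : List (Dart A)) :
    pathLength L (l ++ l') = pathLength L l + pathLength L l' := by
  simp [pathLength]

theorem pathLength_nonneg (hL : ∀ e, 0 ≤ L e) (l : List (Dart A)) : 0 ≤ pathLength L l :=
  List.sum_nonneg fun r hr => by
    obtain ⟨e, -, rfl⟩ := List.mem_map.1 hr
    exact hL e

theorem pathLength_le_of_sublist (hL : ∀ e, 0 ≤ L e) {l l' : List (Dart A)}
    (h : l.Sublist l') : pathLength L l ≤ pathLength L l' := by
  induction h with
  | slnil => exact le_rfl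
  | cons e _ ih => rw [pathLength_cons]; linarith [hL e]
  | cons_cons e _ ih => rw [pathLength_cons, pathLength_cons]; linarith

theorem exists_isPath_of_isChain {e : Dart A} {l : List (Dart A)}
    (h : (e :: l).IsChain Γ.Follows) : ∃ u, Γ.IsPath (Γ.orig e) u (e :: l) := by
  induction l generalizing e with
  | nil => exact ⟨Γ.term e, rfl, rfl⟩
  | cons e' l ih =>
    obtain ⟨h1, h2⟩ := List.isChain_cons_cons.1 h
    obtain ⟨u, hu⟩ := ih h2
    exact ⟨u, rfl, h1.1 ▸ hu⟩

open Classical in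
/-- The reduced paths with `n + 1` edges that start with the oriented edge `e`. -/
noncomputable def pathsFrom [Fintype A] (Γ : Multigraph V A) :
    ℕ → Dart A → Finset (List (Dart A))
  | 0, e => {[e]}
  | n + 1, e => (Finset.univ.filter (Γ.Follows e)).biUnion fun e' =>
      (pathsFrom Γ n e').image (List.cons e)

variable [Fintype A]

theorem mem_pathsFrom {n : ℕ} {e : Dart A} {l : List (Dart A)} :
    l ∈ Γ.pathsFrom n e ↔ ∃ t, l = e :: t ∧ t.length = n ∧ (e :: t).IsChain Γ.Follows := by
  induction n generalizing e l with
  | zero => simp [pathsFrom, List.length_eq_zero_iff]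
  | succ n ih =>
    simp only [pathsFrom, Finset.mem_biUnion, Finset.mem_filter, Finset.mem_univ, true_and,
      Finset.mem_image, ih]
    constructor
    · rintro ⟨e', he', _, ⟨t, rfl, ht, hc⟩, rfl⟩
      exact ⟨e' :: t, rfl, by simp [ht], List.isChain_cons_cons.2 ⟨he', hc⟩⟩
    · rintro ⟨_ | ⟨e', t⟩, rfl, ht, hc⟩
      · simp at ht
      · obtain ⟨he', hc⟩ := List.isChain_cons_cons.1 hc
        exact ⟨e', he', _, ⟨t, rfl, by simpa using ht, hc⟩, rfl⟩

theorem pathsFrom_disjoint {n n' : ℕ} {e e' : Dart A} (h : n ≠ n' ∨ e ≠ e') :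
    Disjoint (Γ.pathsFrom n e) (Γ.pathsFrom n' e') := by
  rw [Finset.disjoint_left]
  intro l hl hl'
  obtain ⟨t, rfl, ht, -⟩ := mem_pathsFrom.1 hl
  obtain ⟨t', h1, ht', -⟩ := mem_pathsFrom.1 hl'
  obtain ⟨rfl, rfl⟩ := List.cons_eq_cons.1 h1
  exact h.elim (fun h => h (ht.symm.trans ht')) fun h => h rfl

/-- The sum of `exp (-σ L(l))` over the reduced paths `l` with `n + 1` edges starting with `e`. -/
noncomputable def pathSum (Γ : Multigraph V A) (L : Dart A → ℝ) (σ : ℝ) (n : ℕ) (e : Dart A) : ℝ :=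
  ∑ l ∈ Γ.pathsFrom n e, Real.exp (-σ * pathLength L l)

theorem pathSum_zero (σ : ℝ) (e : Dart A) : Γ.pathSum L σ 0 e = Real.exp (-σ * L e) := by
  simp [pathSum, pathsFrom, pathLength]

theorem pathSum_succ (σ : ℝ) (n : ℕ) (e : Dart A) :
    Γ.pathSum L σ (n + 1) e =
      Real.exp (-σ * L e) * ∑ e', Γ.lineMatrix e e' * Γ.pathSum L σ n e' := by
  classical
  simp only [pathSum, pathsFrom]
  rw [Finset.sum_biUnion]
  · simp only [lineMatrix, ite_mul, one_mul, zero_mul]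
    rw [← Finset.sum_filter, Finset.mul_sum]
    refine Finset.sum_congr rfl fun e' _ => ?_
    rw [Finset.sum_image (fun _ _ _ _ h => List.tail_eq_of_cons_eq h), Finset.mul_sum]
    refine Finset.sum_congr rfl fun l _ => ?_
    rw [pathLength_cons, mul_add, Real.exp_add]
  · intro e₁ _ e₂ _ h
    exact (Finset.disjoint_image fun _ _ h => List.tail_eq_of_cons_eq h).2
      (pathsFrom_disjoint (Or.inr h))

theorem IsFixedVector.pathSum_le {y : Dart A → ℝ} {s C : ℝ} (h : Γ.IsFixedVector L s y)
    (hC : ∀ e, Real.exp (-s * L e) ≤ C * y e) (n : ℕ) (e : Dart A) :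
    Γ.pathSum L s n e ≤ C * y e := by
  induction n generalizing e with
  | zero => rw [pathSum_zero]; exact hC e
  | succ n ih =>
    rw [pathSum_succ, ← h e, mul_left_comm, Finset.mul_sum (a := C)]
    refine mul_le_mul_of_nonneg_left (Finset.sum_le_sum fun e' _ => ?_) (Real.exp_pos _).le
    rw [mul_left_comm]
    exact mul_le_mul_of_nonneg_left (ih e') (lineMatrix_nonneg _ _)

theorem IsFixedVector.le_pathSum {y : Dart A → ℝ} {s c : ℝ} (h : Γ.IsFixedVector L s y)
    (hc : ∀ e, c * y e ≤ Real.exp (-s * L e)) (n : ℕ) (e : Dart A) :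
    c * y e ≤ Γ.pathSum L s n e := by
  induction n generalizing e with
  | zero => rw [pathSum_zero]; exact hc e
  | succ n ih =>
    rw [pathSum_succ, ← h e, mul_left_comm, Finset.mul_sum (a := c)]
    refine mul_le_mul_of_nonneg_left (Finset.sum_le_sum fun e' _ => ?_) (Real.exp_pos _).le
    rw [mul_left_comm]
    exact mul_le_mul_of_nonneg_left (ih e') (lineMatrix_nonneg _ _)

/-- For a non-singular structure the length of a reduced path grows at least linearly with the
number of its edges: the reduced paths inside the maximal tree have boundedly many edges. -/
theorem IsNonsingular.length_le [Finite V] (hL : ∀ e, 0 ≤ L e) (h : Γ.IsNonsingular L) :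
    ∃ M K : ℝ, 0 < K ∧ ∀ l : List (Dart A), l.IsChain Γ.Follows →
      (l.length : ℝ) ≤ M + K * pathLength L l := by
  classical
  have := Fintype.ofFinite V
  obtain ⟨T, hT, hpos⟩ := h
  choose t ht hu using hT
  obtain ⟨M, hM0, hM⟩ : ∃ M : ℕ, 0 < M ∧ ∀ u v, (t u v).length < M := by
    refine ⟨∑ u, ∑ v, (t u v).length + 1, by omega, fun u v => Nat.lt_succ_of_le ?_⟩
    calc (t u v).length ≤ ∑ v, (t u v).length :=
          Finset.single_le_sum (f := fun v => (t u v).length) (fun _ _ => Nat.zero_le _)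
            (Finset.mem_univ v)
      _ ≤ ∑ u, ∑ v, (t u v).length :=
          Finset.single_le_sum (f := fun u => ∑ v, (t u v).length) (fun _ _ => Nat.zero_le _)
            (Finset.mem_univ u)
  obtain ⟨δ, hδ, hδL⟩ : ∃ δ : ℝ, 0 < δ ∧ ∀ e : Dart A, e.1 ∉ T → δ ≤ L e := by
    let S : Finset (Dart A) := Finset.univ.filter fun e => e.1 ∉ T
    rcases S.eq_empty_or_nonempty with hS | hS
    · refine ⟨1, one_pos, fun e he => ?_⟩
      have : e ∈ S := by simpa [S] using he
      simp [hS] at this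
    · obtain ⟨e₁, he₁, hmin⟩ := S.exists_min_image L hS
      exact ⟨L e₁, hpos e₁ (by simpa [S] using he₁), fun e he => hmin e (by simpa [S] using he)⟩
  have hlong : ∀ l : List (Dart A), l.IsChain Γ.Follows → M ≤ l.length → δ ≤ pathLength L l := by
    intro l hc hl
    by_cases hlT : ∀ e ∈ l, e.1 ∈ T
    · exfalso
      cases l with
      | nil => simp at hl; omega
      | cons e l =>
        obtain ⟨u, hpath⟩ := exists_isPath_of_isChain hc
        have := hu _ _ _ ⟨hpath, isReduced_of_isChain_follows hc, hlT⟩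
        rw [this] at hl
        exact absurd (hM _ _) (not_lt.2 hl)
    · push Not at hlT
      obtain ⟨e, he, heT⟩ := hlT
      refine (hδL e heT).trans ?_
      have := pathLength_le_of_sublist hL (List.singleton_sublist.2 he)
      simpa [pathLength] using this
  refine ⟨M, M / δ, by positivity, fun l => ?_⟩
  induction hn : l.length using Nat.strong_induction_on generalizing l with
  | _ n ih =>
    intro hc
    by_cases hlM : n < M
    · have h1 : (n : ℝ) ≤ M := by exact_mod_cast hlM.le
      have h2 : 0 ≤ (M : ℝ) / δ * pathLength L l :=
        mul_nonneg (by positivity) (pathLength_nonneg hL l)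
      linarith
    · push Not at hlM
      -- The first `M` edges contain one outside the tree, of length at least `δ`.
      have hsplit := List.take_append_drop M l
      have h1 : δ ≤ pathLength L (l.take M) :=
        hlong _ (hc.take M) (by rw [List.length_take, hn]; omega)
      have h2 := ih (n - M) (by omega) (l.drop M) (by rw [List.length_drop, hn]) (hc.drop M)
      rw [Nat.cast_sub hlM] at h2
      have h3 : pathLength L l = pathLength L (l.take M) + pathLength L (l.drop M) := by
        rw [← pathLength_append, hsplit]
      have h4 : (M : ℝ) / δ * δ = M := by field_simp
      have h5 : (M : ℝ) / δ * δ ≤ M / δ * pathLength L (l.take M) :=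
        mul_le_mul_of_nonneg_left h1 (by positivity)
      rw [h3, mul_add]
      linarith

/-- Above the exponent of a positive fixed vector, the sum over all reduced paths converges. -/
theorem IsFixedVector.summable_exp [Finite V] {y : Dart A → ℝ} {s σ : ℝ}
    (h : Γ.IsFixedVector L s y) (hy : ∀ e, 0 < y e) (hL : ∀ e, 0 ≤ L e)
    (hns : Γ.IsNonsingular L) (hσ : s < σ) :
    Summable fun l : {l : List (Dart A) // l.IsChain Γ.Follows} =>
      Real.exp (-σ * pathLength L l.1) := by
  classical
  obtain ⟨M, K, hK, hMK⟩ := hns.length_le hL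
  obtain ⟨C, hC⟩ : ∃ C, ∀ e, Real.exp (-s * L e) ≤ C * y e := by
    obtain ⟨C, hC⟩ := Finite.exists_le fun e => Real.exp (-s * L e) / y e
    exact ⟨C, fun e => (div_le_iff₀ (hy e)).1 (hC e)⟩
  let κ := (σ - s) / K
  have hκ : 0 < κ := div_pos (sub_pos.2 hσ) hK
  let θ := Real.exp (-κ)
  have hθ1 : θ < 1 := Real.exp_lt_one_iff.2 (neg_lt_zero.2 hκ)
  have hdecay : ∀ n e, Γ.pathSum L σ n e ≤ Real.exp (κ * M) * (C * y e) * θ ^ n := by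
    intro n e
    calc Γ.pathSum L σ n e
        ≤ ∑ l ∈ Γ.pathsFrom n e,
            Real.exp (κ * M) * θ ^ n * Real.exp (-s * pathLength L l) := by
          refine Finset.sum_le_sum fun l hl => ?_
          obtain ⟨t, rfl, ht, hc⟩ := mem_pathsFrom.1 hl
          have h1 := hMK _ hc
          rw [List.length_cons, ht] at h1
          push_cast at h1
          rw [← Real.exp_nat_mul, ← Real.exp_add, ← Real.exp_add, Real.exp_le_exp]
          have h2 : κ * n ≤ κ * (M + K * pathLength L (e :: t)) :=
            mul_le_mul_of_nonneg_left (by linarith) hκ.le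
          have h3 : κ * K = σ - s := div_mul_cancel₀ _ hK.ne'
          have h4 : κ * (M + K * pathLength L (e :: t)) =
              κ * M + (σ - s) * pathLength L (e :: t) := by rw [mul_add, ← mul_assoc, h3]
          linarith
      _ = Real.exp (κ * M) * θ ^ n * Γ.pathSum L s n e := by rw [pathSum, Finset.mul_sum]
      _ ≤ Real.exp (κ * M) * θ ^ n * (C * y e) :=
          mul_le_mul_of_nonneg_left (h.pathSum_le hC n e) (by positivity)
      _ = _ := by ring
  have hgeom : ∀ N : ℕ, ∑ n ∈ Finset.range N, θ ^ n ≤ (1 - θ)⁻¹ := fun N => by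
    rw [← tsum_geometric_of_lt_one (Real.exp_pos _).le hθ1]
    exact (summable_geometric_of_lt_one (Real.exp_pos _).le hθ1).sum_le_tsum _
      fun n _ => pow_nonneg (Real.exp_pos _).le n
  refine summable_of_sum_le
    (c := 1 + ∑ e, Real.exp (κ * M) * (C * y e) * (1 - θ)⁻¹) (fun l => (Real.exp_pos _).le) ?_
  intro S
  let S' := S.map (Function.Embedding.subtype _)
  let N := S'.sup List.length
  let Q : Finset (List (Dart A)) :=
    (Finset.univ ×ˢ Finset.range N).biUnion fun q => Γ.pathsFrom q.2 q.1
  have hsub : S' ⊆ insert [] Q := by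
    intro l hl
    have hlN : l.length ≤ N := Finset.le_sup (f := List.length) hl
    obtain ⟨⟨l, hc⟩, -, rfl⟩ := Finset.mem_map.1 hl
    rcases l with _ | ⟨e, t⟩
    · exact Finset.mem_insert_self _ _
    · refine Finset.mem_insert_of_mem (Finset.mem_biUnion.2 ⟨(e, t.length), ?_, ?_⟩)
      · simpa using hlN
      · exact mem_pathsFrom.2 ⟨t, rfl, rfl, hc⟩
  have hnil : [] ∉ Q := fun hm => by
    obtain ⟨q, -, hq⟩ := Finset.mem_biUnion.1 hm
    obtain ⟨t, ht, -⟩ := mem_pathsFrom.1 hq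
    simp at ht
  have hS : ∑ l ∈ S, Real.exp (-σ * pathLength L l.1) =
      ∑ l ∈ S', Real.exp (-σ * pathLength L l) := by
    rw [Finset.sum_map]; rfl
  rw [hS]
  refine (Finset.sum_le_sum_of_subset_of_nonneg hsub fun l _ _ => (Real.exp_pos _).le).trans ?_
  rw [Finset.sum_insert hnil]
  refine add_le_add (by simp [pathLength]) ?_
  rw [Finset.sum_biUnion, Finset.sum_product]
  · refine Finset.sum_le_sum fun e _ => ?_
    refine (Finset.sum_le_sum fun n _ => hdecay n e).trans ?_
    rw [← Finset.mul_sum]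
    refine mul_le_mul_of_nonneg_left (hgeom N) (mul_nonneg (Real.exp_pos _).le ?_)
    exact (Real.exp_pos _).le.trans (hC e)
  · rintro ⟨e, n⟩ - ⟨e', n'⟩ - hne
    refine pathsFrom_disjoint ?_
    by_contra! hcon
    exact hne (Prod.ext hcon.2 hcon.1)

end PathSums

/-! ### The critical exponent -/

section CriticalExponent

variable {Γ : Multigraph V A} {L : Dart A → ℝ} {p : V}

theorem coverDist_le (hL : ∀ e, 0 ≤ L e) {x z : Γ.CoverVertex p} {l : List (Dart A)}
    (h : Γ.IsPath x.1.2 z.1.2 l) (hz : z.1.1 = x.1.1 * FreeGroup.mk l) :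
    Γ.coverDist p L x z ≤ pathLength L l := by
  obtain ⟨l', h', hr, hmk, hsub⟩ := h.exists_reduced
  rw [coverDist_eq h' hr (by rw [hmk, hz])]
  exact pathLength_le_of_sublist hL hsub

theorem coverDist_actVertex_nonneg (hL : ∀ e, 0 ≤ L e) (g : Γ.fundGroup p)
    (x : Γ.CoverVertex p) : 0 ≤ Γ.coverDist p L x (Γ.actVertex p g x) := by
  obtain ⟨l, -, -, -, h⟩ := exists_path_actVertex (L := L) g x
  rw [h]
  exact pathLength_nonneg hL l

theorem IsFixedVector.summable_poincare [Finite V] [Fintype A] {y : Dart A → ℝ} {s σ : ℝ}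
    (h : Γ.IsFixedVector L s y) (hy : ∀ e, 0 < y e) (hL : ∀ e, 0 ≤ L e)
    (hns : Γ.IsNonsingular L) (hσ : s < σ) (x : Γ.CoverVertex p) :
    Summable fun g : Γ.fundGroup p =>
      Real.exp (-σ * Γ.coverDist p L x (Γ.actVertex p g x)) := by
  choose l hpath hred hmk hdist using fun g : Γ.fundGroup p => exists_path_actVertex (L := L) g x
  let ι : Γ.fundGroup p → {l : List (Dart A) // l.IsChain Γ.Follows} :=
    fun g => ⟨l g, (hpath g).isChain_follows (hred g)⟩
  have hι : Function.Injective ι := by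
    intro g g' hgg
    have h1 : l g = l g' := congrArg Subtype.val hgg
    have h2 := hmk g
    rw [h1, hmk g'] at h2
    exact Subtype.ext (mul_left_cancel (mul_right_cancel h2)).symm
  refine ((h.summable_exp hy hL hns hσ).comp_injective hι).congr fun g => ?_
  simp only [Function.comp_apply, hdist]
  rfl

/-- At the exponent `s` of a positive fixed vector, the sums over the reduced paths with a given
number of edges are bounded below. A reduced path starting at the image of `x` becomes closed
after adding one of finitely many paths, so the Poincaré series diverges. -/
theorem IsFixedVector.not_summable_poincare [Finite V] [Fintype A] {y : Dart A → ℝ} {s : ℝ}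
    (h : Γ.IsFixedVector L s y) (hy : ∀ e, 0 < y e) (hL : ∀ e, 0 ≤ L e) (hs : 0 ≤ s)
    (hconn : Γ.IsConnected) [hne : Nonempty (Dart A)] (x : Γ.CoverVertex p) :
    ¬ Summable fun g : Γ.fundGroup p =>
      Real.exp (-s * Γ.coverDist p L x (Γ.actVertex p g x)) := by
  classical
  have := Fintype.ofFinite V
  intro hsum
  obtain ⟨e₀, he₀⟩ : ∃ e, Γ.orig e = x.1.2 := by
    obtain ⟨e⟩ := hne
    obtain ⟨_ | ⟨f, l⟩, hl⟩ := hconn x.1.2 (Γ.orig e)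
    · exact ⟨e, hl.symm⟩
    · exact ⟨f, hl.1⟩
  obtain ⟨c, hc0, hc⟩ : ∃ c : ℝ, 0 < c ∧ ∀ e, c * y e ≤ Real.exp (-s * L e) := by
    obtain ⟨e₁, he₁⟩ := Finite.exists_min fun e => Real.exp (-s * L e) / y e
    exact ⟨_, div_pos (Real.exp_pos _) (hy e₁), fun e => (le_div_iff₀ (hy e)).1 (he₁ e)⟩
  choose r hr using fun u => hconn u x.1.2
  obtain ⟨D, hD⟩ := Finite.exists_le fun u => pathLength L (r u)
  have hend : ∀ l : List (Dart A), ∃ u, (∃ n, l ∈ Γ.pathsFrom n e₀) → Γ.IsPath x.1.2 u l := by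
    intro l
    by_cases hl : ∃ n, l ∈ Γ.pathsFrom n e₀
    · obtain ⟨n, hn⟩ := hl
      obtain ⟨t, rfl, -, hch⟩ := mem_pathsFrom.1 hn
      obtain ⟨u, hu⟩ := exists_isPath_of_isChain hch
      exact ⟨u, fun _ => he₀ ▸ hu⟩
    · exact ⟨x.1.2, fun h => absurd h hl⟩
  choose u hu using hend
  have hclosed : ∀ l : List (Dart A), ∃ g : Γ.fundGroup p, (∃ n, l ∈ Γ.pathsFrom n e₀) →
      g.1 = x.1.1 * FreeGroup.mk (l ++ r (u l)) * x.1.1⁻¹ := by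
    intro l
    by_cases hl : ∃ n, l ∈ Γ.pathsFrom n e₀
    · obtain ⟨lx, hlx, hx⟩ := x.2
      have hmem : x.1.1 * FreeGroup.mk (l ++ r (u l)) * x.1.1⁻¹ ∈ Γ.fundGroup p := by
        refine ⟨lx ++ (l ++ r (u l)) ++ FreeGroup.invRev lx,
          (hlx.append ((hu l hl).append (hr _))).append hlx.invRev, ?_⟩
        rw [← hx, FreeGroup.inv_mk, FreeGroup.mul_mk, FreeGroup.mul_mk]
      exact ⟨⟨_, hmem⟩, fun _ => rfl⟩
    · exact ⟨1, fun h => absurd h hl⟩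
  choose g hg using hclosed
  -- A path is not determined by the closed path alone; one also has to record its end point.
  let F : V × Γ.fundGroup p → ℝ := fun q =>
    1 * Real.exp (-s * Γ.coverDist p L x (Γ.actVertex p q.2 x))
  have hF0 : ∀ q, 0 ≤ F q := fun q => by positivity
  have hF : Summable F := by
    refine Summable.mul_of_nonneg (f := fun _ : V => (1 : ℝ))
      (g := fun g => Real.exp (-s * Γ.coverDist p L x (Γ.actVertex p g x)))
      (hasSum_fintype _).summable hsum
      (fun _ => zero_le_one) fun _ => (Real.exp_pos _).le
  have hterm : ∀ l, (∃ n, l ∈ Γ.pathsFrom n e₀) →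
      Real.exp (-s * pathLength L l) ≤ Real.exp (s * D) * F (u l, g l) := by
    intro l hl
    have h1 : Γ.coverDist p L x (Γ.actVertex p (g l) x) ≤ pathLength L (l ++ r (u l)) := by
      refine coverDist_le hL ((hu l hl).append (hr _)) ?_
      simp [actVertex, hg l hl]
    rw [pathLength_append] at h1
    simp only [F, one_mul]
    rw [← Real.exp_add, Real.exp_le_exp]
    have h2 := mul_le_mul_of_nonneg_left (h1.trans (add_le_add_right (hD (u l)) _)) hs
    linarith
  have hbound : ∀ N : ℕ, N * (c * y e₀) ≤ Real.exp (s * D) * ∑' q, F q := by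
    intro N
    let Q : Finset (List (Dart A)) := (Finset.range N).biUnion fun n => Γ.pathsFrom n e₀
    have hQ : ∀ l ∈ Q, ∃ n, l ∈ Γ.pathsFrom n e₀ := fun l hl => by
      obtain ⟨n, -, hn⟩ := Finset.mem_biUnion.1 hl
      exact ⟨n, hn⟩
    have hinj : Set.InjOn (fun l => (u l, g l)) Q := by
      intro l hl l' hl' heq
      obtain ⟨h1, h2⟩ := Prod.mk.inj heq
      have h3 := hg l (hQ l hl)
      rw [h2, hg l' (hQ l' hl'), h1] at h3
      have h4 := mul_left_cancel (mul_right_cancel h3)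
      rw [← FreeGroup.mul_mk, ← FreeGroup.mul_mk] at h4
      have hred : ∀ l ∈ Q, IsReduced l := fun l hl => by
        obtain ⟨n, hn⟩ := hQ l hl
        obtain ⟨t, rfl, -, hch⟩ := mem_pathsFrom.1 hn
        exact isReduced_of_isChain_follows hch
      exact ((hred l' hl').eq_of_mk_eq (hred l hl) (mul_right_cancel h4)).symm
    calc (N : ℝ) * (c * y e₀) = ∑ n ∈ Finset.range N, c * y e₀ := by simp
      _ ≤ ∑ n ∈ Finset.range N, Γ.pathSum L s n e₀ :=
          Finset.sum_le_sum fun n _ => h.le_pathSum hc n e₀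
      _ = ∑ l ∈ Q, Real.exp (-s * pathLength L l) := by
          rw [Finset.sum_biUnion fun n _ n' _ hnn => pathsFrom_disjoint (Or.inl hnn)]
          rfl
      _ ≤ ∑ l ∈ Q, Real.exp (s * D) * F (u l, g l) :=
          Finset.sum_le_sum fun l hl => hterm l (hQ l hl)
      _ = Real.exp (s * D) * ∑ q ∈ Q.image (fun l => (u l, g l)), F q := by
          rw [← Finset.mul_sum, Finset.sum_image hinj]
      _ ≤ Real.exp (s * D) * ∑' q, F q :=
          mul_le_mul_of_nonneg_left (hF.sum_le_tsum _ fun q _ => hF0 q) (Real.exp_pos _).le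
  have hcy : 0 < c * y e₀ := mul_pos hc0 (hy e₀)
  obtain ⟨N, hN⟩ := exists_nat_gt ((Real.exp (s * D) * ∑' q, F q) / (c * y e₀))
  rw [div_lt_iff₀ hcy] at hN
  exact absurd (hbound N) (not_le.2 hN)

theorem IsFixedVector.isCriticalExponent [Finite V] [Fintype A] {F : Type*} [Group F]
    (α : F ≃* Γ.fundGroup p) {y : Dart A → ℝ} {s : ℝ}
    (h : Γ.IsFixedVector L s y) (hy : ∀ e, 0 < y e) (hL : ∀ e, 0 ≤ L e) (hs : 0 ≤ s)
    (hns : Γ.IsNonsingular L) (hconn : Γ.IsConnected) [Nonempty (Dart A)] :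
    Γ.IsCriticalExponent p α L s := by
  have transport : ∀ (σ : ℝ) (x : Γ.CoverVertex p),
      (Summable fun g : F => Real.exp (-σ * Γ.coverDist p L x (Γ.actVertex p (α g) x))) ↔
      Summable fun g => Real.exp (-σ * Γ.coverDist p L x (Γ.actVertex p g x)) := fun σ x =>
    Equiv.summable_iff (f := fun g => Real.exp (-σ * Γ.coverDist p L x (Γ.actVertex p g x)))
      α.toEquiv
  refine ⟨hs, fun x => ⟨fun σ hσ => ?_, fun σ hσ hsum => ?_⟩⟩
  · rw [transport]
    exact h.summable_poincare hy hL hns hσ x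
  · rw [transport] at hsum
    refine h.not_summable_poincare hy hL hs hconn x
      (Summable.of_nonneg_of_le (fun _ => (Real.exp_pos _).le) (fun g => ?_) hsum)
    refine Real.exp_le_exp.2 ?_
    nlinarith [coverDist_actVertex_nonneg hL g x]

end CriticalExponent

/-! ### Rays, ends and Busemann functions -/

section Rays

variable {X : Multigraph V A}

/-- The ray obtained by dropping the first edge. -/
def Ray.tail (r : X.Ray) : X.Ray := ⟨fun n => r.1 (n + 1), fun n => r.2 (n + 1)⟩

theorem Ray.mk_tail (r : X.Ray) : Quotient.mk X.raySetoid r.tail = Quotient.mk X.raySetoid r :=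
  Quotient.sound ⟨0, 1, fun k => congrArg r.1 (by omega)⟩

/-- The ray obtained by adding a first edge. -/
def Ray.cons (f : Dart A) (r : X.Ray) (h : X.Follows f (r.1 0)) : X.Ray :=
  ⟨fun n => n.casesOn f r.1, fun n => by
    cases n with
    | zero => exact h
    | succ n => exact r.2 n⟩

theorem Ray.mk_cons {f : Dart A} {r : X.Ray} (h : X.Follows f (r.1 0)) :
    Quotient.mk X.raySetoid (r.cons f h) = Quotient.mk X.raySetoid r :=
  ((r.cons f h).mk_tail).symm

theorem Ray.exists_path (r : X.Ray) (n : ℕ) :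
    ∃ l, X.IsPath (X.orig (r.1 0)) (X.orig (r.1 (n + 1))) (r.1 0 :: l) ∧
      IsReduced (r.1 0 :: l) := by
  induction n generalizing r with
  | zero => exact ⟨[], ⟨rfl, (r.2 0).1.symm⟩, List.isChain_singleton _⟩
  | succ n ih =>
    obtain ⟨l, hl, hr⟩ := ih r.tail
    refine ⟨r.1 1 :: l, ⟨rfl, ?_⟩, List.isChain_cons_cons.2 ⟨(r.2 0).2, hr⟩⟩
    rw [← (r.2 0).1]
    exact hl

theorem Ray.tendsto_nhdsEnd (r : X.Ray) :
    Tendsto (fun n => X.orig (r.1 n)) atTop (X.nhdsEnd (Quotient.mk X.raySetoid r)) := by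
  simp only [nhdsEnd, tendsto_iInf, tendsto_principal]
  rintro f ⟨r', rfl, hr'⟩
  obtain ⟨m, n, hmn⟩ := Quotient.exact hr'
  filter_upwards [eventually_ge_atTop (n + 1)] with N hN
  obtain ⟨k, rfl⟩ := Nat.exists_eq_add_of_le hN
  obtain ⟨l, hl, hred⟩ := r'.exists_path (m + k)
  have h1 := hmn (k + 1)
  rw [show n + 1 + k = n + (k + 1) by omega, ← h1]
  exact ⟨l, hl, hred⟩

theorem nhdsEnd_neBot (ζ : X.Boundary) : (X.nhdsEnd ζ).NeBot := by
  obtain ⟨r, rfl⟩ := Quotient.exists_rep ζ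
  exact r.tendsto_nhdsEnd.neBot

theorem halfTree_mem_nhdsEnd {ζ : X.Boundary} {f : Dart A} (h : ζ ∈ X.cyl f) :
    X.halfTree f ∈ X.nhdsEnd ζ :=
  mem_iInf_of_mem f (mem_iInf_of_mem h (mem_principal_self _))

theorem measurableSet_cyl (f : Dart A) : MeasurableSet (X.cyl f) :=
  have : IsOpen (X.cyl f) := TopologicalSpace.isOpen_generateFrom_of_mem ⟨f, rfl⟩
  this.measurableSet

theorem cyl_subset_of_follows {f f' : Dart A} (h : X.Follows f f') : X.cyl f' ⊆ X.cyl f := by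
  rintro _ ⟨r, rfl, rfl⟩
  exact ⟨r.cons f h, rfl, Ray.mk_cons h⟩

theorem exists_follows_of_mem_cyl {f : Dart A} {ζ : X.Boundary} (h : ζ ∈ X.cyl f) :
    ∃ f', X.Follows f f' ∧ ζ ∈ X.cyl f' := by
  obtain ⟨r, rfl, rfl⟩ := h
  exact ⟨r.1 1, r.2 0, r.tail, rfl, r.mk_tail⟩

end Rays

/-! ### Conformal densities and cylinders -/

section ConformalDensity

variable {Γ : Multigraph V A} {p : V} {L : Dart A → ℝ}

theorem cyl_cover_disjoint {f f' : Dart (Γ.CoverEdge p)}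
    (h : (Γ.cover p).orig f = (Γ.cover p).orig f') (hne : f ≠ f') :
    Disjoint ((Γ.cover p).cyl f) ((Γ.cover p).cyl f') := by
  rw [Set.disjoint_left]
  rintro _ ⟨r, rfl, rfl⟩ ⟨r', rfl, hr'⟩
  obtain ⟨m, n, hmn⟩ := Quotient.exact hr'
  obtain ⟨l, hl, hred⟩ := r.exists_path n
  obtain ⟨l', hl', hred'⟩ := r'.exists_path m
  rw [hmn 1, ← h] at hl'
  exact hne (List.cons_eq_cons.1 (hl.cover_unique hred hl' hred')).1

theorem busemann_cover_eq {M : Dart (Γ.CoverEdge p) → ℝ} {f : Dart (Γ.CoverEdge p)}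
    {ζ : (Γ.cover p).Boundary} (h : ζ ∈ (Γ.cover p).cyl f) :
    (Γ.cover p).busemann M ζ ((Γ.cover p).orig f) ((Γ.cover p).term f) = M f := by
  have := nhdsEnd_neBot ζ
  refine Tendsto.limUnder_eq (tendsto_const_nhds.congr' ?_)
  filter_upwards [halfTree_mem_nhdsEnd h] with z hz
  obtain ⟨l, hl, hr⟩ := hz
  rw [treeDist_cover_eq hl hr, treeDist_cover_eq hl.2 hr.tail, pathLength_cons,
    add_sub_cancel_right]

theorem actDart_inv_actDart (g : Γ.fundGroup p) (f : Dart (Γ.CoverEdge p)) :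
    Γ.actDart p g⁻¹ (Γ.actDart p g f) = f := by
  refine Prod.ext (Subtype.ext (Prod.ext (Subtype.ext (Prod.ext ?_ rfl)) rfl)) rfl
  exact inv_mul_cancel_left g.1 _

theorem actBoundary_preimage_cyl (g : Γ.fundGroup p) (f : Dart (Γ.CoverEdge p)) :
    Γ.actBoundary p g ⁻¹' (Γ.cover p).cyl (Γ.actDart p g f) = (Γ.cover p).cyl f := by
  ext ζ
  obtain ⟨r, rfl⟩ := Quotient.exists_rep ζ
  constructor
  · rintro ⟨r', hr', hq⟩
    obtain ⟨m, n, hmn⟩ := Quotient.exact hq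
    refine ⟨Γ.actRay p g⁻¹ r', ?_, Quotient.sound ⟨m, n, fun k => ?_⟩⟩
    · change Γ.actDart p g⁻¹ (r'.1 0) = f
      rw [hr', actDart_inv_actDart]
    · change Γ.actDart p g⁻¹ (r'.1 (m + k)) = r.1 (n + k)
      rw [hmn k]
      exact actDart_inv_actDart g _
  · rintro ⟨r', hr', hq⟩
    obtain ⟨m, n, hmn⟩ := Quotient.exact hq
    exact ⟨Γ.actRay p g r', congrArg (Γ.actDart p g) hr',
      Quotient.sound ⟨m, n, fun k => congrArg (Γ.actDart p g) (hmn k)⟩⟩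

theorem exists_actDart_eq {f f' : Dart (Γ.CoverEdge p)} (h : Γ.proj p f = Γ.proj p f') :
    ∃ g : Γ.fundGroup p, Γ.actDart p g f = f' := by
  obtain ⟨⟨⟨x, a⟩, hx⟩, b⟩ := f
  obtain ⟨⟨⟨x', a'⟩, hx'⟩, b'⟩ := f'
  obtain ⟨rfl, rfl⟩ : a = a' ∧ b = b' := Prod.mk.inj h
  obtain ⟨l, hl, hxl⟩ := x.2
  obtain ⟨l', hl', hxl'⟩ := x'.2
  have hend : x'.1.2 = x.1.2 := Eq.trans hx' (Eq.symm hx)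
  have hmem : x'.1.1 * x.1.1⁻¹ ∈ Γ.fundGroup p := by
    refine ⟨l' ++ FreeGroup.invRev l, hl'.append (hend ▸ hl.invRev), ?_⟩
    rw [← hxl, ← hxl', FreeGroup.inv_mk, FreeGroup.mul_mk]
  refine ⟨⟨_, hmem⟩, Prod.ext (Subtype.ext (Prod.ext (Subtype.ext (Prod.ext ?_ ?_)) rfl)) rfl⟩
  · exact inv_mul_cancel_right _ _
  · exact hend.symm

theorem countable_dart_cover [Countable A] [Countable V] : Countable (Dart (Γ.CoverEdge p)) := by
  have h1 : Countable (FreeGroup A) :=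
    Function.Surjective.countable (f := fun l : List (Dart A) => FreeGroup.mk l)
      fun g => Quot.exists_rep g
  have h2 : Countable (Γ.CoverVertex p) := Subtype.countable
  have h3 : Countable (Γ.CoverEdge p) := Subtype.countable
  infer_instance

namespace IsConformalDensity

variable {F : Type*} [Group F] {α : F ≃* Γ.fundGroup p} {σ : ℝ}
  {μ : Γ.CoverVertex p → Measure (Γ.cover p).Boundary}

theorem measure_cyl_eq (h : Γ.IsConformalDensity p α L σ μ) {f f' : Dart (Γ.CoverEdge p)}
    (hf : Γ.proj p f = Γ.proj p f') :
    (μ ((Γ.cover p).orig f)).real ((Γ.cover p).cyl f) =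
      (μ ((Γ.cover p).orig f')).real ((Γ.cover p).cyl f') := by
  obtain ⟨g, rfl⟩ := exists_actDart_eq hf
  have := h.equivariant (α.symm g) ((Γ.cover p).orig f) _ (measurableSet_cyl (Γ.actDart p g f))
  rw [MulEquiv.apply_symm_apply, actBoundary_preimage_cyl, ← orig_actDart] at this
  rw [Measure.real, Measure.real, this]

/-- The masses of the cylinders form a fixed vector: the cylinder of an edge is the disjoint union
of the cylinders of its successors, and the Busemann function that compares the measures at the
two ends of the edge is constant on it. -/
theorem measure_cyl_succ [Fintype A] (h : Γ.IsConformalDensity p α L σ μ) {w : Dart A → ℝ}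
    (hw : ∀ f, (μ ((Γ.cover p).orig f)).real ((Γ.cover p).cyl f) = w (Γ.proj p f))
    (f : Dart (Γ.CoverEdge p)) :
    Real.exp (-σ * L (Γ.proj p f)) * ∑ e', Γ.lineMatrix (Γ.proj p f) e' * w e' =
      w (Γ.proj p f) := by
  classical
  have hfin := h.finite
  have h1 : (μ ((Γ.cover p).orig f)).real ((Γ.cover p).cyl f) = Real.exp (-σ * L (Γ.proj p f)) *
      (μ ((Γ.cover p).term f)).real ((Γ.cover p).cyl f) := by
    have h2 : μ ((Γ.cover p).orig f) ((Γ.cover p).cyl f) =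
        ENNReal.ofReal (Real.exp (-σ * L (Γ.proj p f))) *
          μ ((Γ.cover p).term f) ((Γ.cover p).cyl f) := by
      rw [h.density ((Γ.cover p).orig f) ((Γ.cover p).term f),
        withDensity_apply _ (measurableSet_cyl f),
        setLIntegral_congr_fun (g := fun _ => ENNReal.ofReal (Real.exp (-σ * L (Γ.proj p f))))
          (measurableSet_cyl f) fun ζ hζ => ?_, setLIntegral_const]
      simp only [busemann_cover_eq hζ]
      rfl
    rw [Measure.real, h2, ENNReal.toReal_mul, ENNReal.toReal_ofReal (Real.exp_pos _).le]
    rfl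
  have hlift : ∀ e', ∃ f', Γ.Follows (Γ.proj p f) e' →
      (Γ.cover p).orig f' = (Γ.cover p).term f ∧ Γ.proj p f' = e' := fun e' => by
    by_cases he' : Γ.Follows (Γ.proj p f) e'
    · obtain ⟨f', hf'⟩ := exists_lift ((Γ.cover p).term f)
        (he'.1.trans (term_cover_snd f).symm)
      exact ⟨f', fun _ => hf'⟩
    · exact ⟨f, fun h => absurd h he'⟩
  choose lft hlft using hlift
  have hunion : (Γ.cover p).cyl f =
      ⋃ e' ∈ Finset.univ.filter (Γ.Follows (Γ.proj p f)), (Γ.cover p).cyl (lft e') := by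
    refine Set.Subset.antisymm (fun ζ hζ => ?_) (Set.iUnion₂_subset fun e' he' => ?_)
    · obtain ⟨f', hff, hζ'⟩ := exists_follows_of_mem_cyl hζ
      obtain ⟨ho, hfol⟩ := follows_cover_iff.1 hff
      obtain ⟨ho', hp'⟩ := hlft _ hfol
      refine Set.mem_biUnion (x := Γ.proj p f') (by simpa using hfol) ?_
      rwa [dart_cover_ext (ho'.trans ho.symm) hp']
    · have hfol : Γ.Follows (Γ.proj p f) e' := by simpa using he'
      obtain ⟨ho', hp'⟩ := hlft _ hfol
      exact cyl_subset_of_follows (follows_cover_iff.2 ⟨ho', hp'.symm ▸ hfol⟩)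
  have h3 : (μ ((Γ.cover p).term f)).real ((Γ.cover p).cyl f) =
      ∑ e', Γ.lineMatrix (Γ.proj p f) e' * w e' := by
    rw [hunion, measureReal_biUnion_finset]
    · simp only [lineMatrix, ite_mul, one_mul, zero_mul]
      rw [← Finset.sum_filter]
      refine Finset.sum_congr rfl fun e' he' => ?_
      obtain ⟨ho', hp'⟩ := hlft e' (by simpa using he')
      rw [← ho', hw, hp']
    · intro e₁ he₁ e₂ he₂ hne
      obtain ⟨ho₁, hp₁⟩ := hlft e₁ (by simpa using he₁)
      obtain ⟨ho₂, hp₂⟩ := hlft e₂ (by simpa using he₂)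
      exact cyl_cover_disjoint (ho₁.trans ho₂.symm) fun heq => hne (by rw [← hp₁, heq, hp₂])
    · exact fun e' _ => measurableSet_cyl _
  rw [← h3, ← h1, hw]

theorem exists_measure_cyl_ne_zero [Countable A] [Countable V]
    (h : Γ.IsConformalDensity p α L σ μ) (hμ : ∃ x, μ x ≠ 0) :
    ∃ f, (μ ((Γ.cover p).orig f)).real ((Γ.cover p).cyl f) ≠ 0 := by
  by_contra! hzero
  have hfin := h.finite
  have := countable_dart_cover (Γ := Γ) (p := p)
  obtain ⟨x, hx⟩ := hμ
  refine hx (Measure.measure_univ_eq_zero.1 ?_)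
  have hcover : (Set.univ : Set (Γ.cover p).Boundary) ⊆ ⋃ f, (Γ.cover p).cyl f := by
    intro ζ _
    obtain ⟨r, rfl⟩ := Quotient.exists_rep ζ
    exact Set.mem_iUnion.2 ⟨r.1 0, r, rfl, rfl⟩
  refine measure_mono_null hcover (measure_iUnion_null fun f => ?_)
  rw [h.density x ((Γ.cover p).orig f)]
  exact withDensity_absolutelyContinuous _ _
    ((measureReal_eq_zero_iff (measure_ne_top _ _)).1 (hzero f))

/-- The mass of the cylinder of an edge of the universal cover depends only on the image of the
edge, and the resulting vector is a nonnegative nonzero fixed vector. -/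
theorem exists_fixedVector [Finite V] [Fintype A] (h : Γ.IsConformalDensity p α L σ μ)
    (hconn : Γ.IsConnected) (hμ : ∃ x, μ x ≠ 0) :
    ∃ w : Dart A → ℝ, Γ.IsFixedVector L σ w ∧ (∀ e, 0 ≤ w e) ∧ (∃ e, w e ≠ 0) ∧
      ∀ f, (μ ((Γ.cover p).orig f)).real ((Γ.cover p).cyl f) = w (Γ.proj p f) := by
  have hlift : ∀ e, ∃ f, Γ.proj p f = e := fun e => by
    obtain ⟨l, hl⟩ := hconn p (Γ.orig e)
    obtain ⟨f, -, hf⟩ := exists_lift (Γ := Γ) (p := p) ⟨(FreeGroup.mk l, Γ.orig e), l, hl, rfl⟩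
      (e := e) rfl
    exact ⟨f, hf⟩
  choose lft hlft using hlift
  let w : Dart A → ℝ := fun e =>
    (μ ((Γ.cover p).orig (lft e))).real ((Γ.cover p).cyl (lft e))
  have hw : ∀ f, (μ ((Γ.cover p).orig f)).real ((Γ.cover p).cyl f) = w (Γ.proj p f) := fun f =>
    h.measure_cyl_eq (hlft _).symm
  refine ⟨w, fun e => ?_, fun e => measureReal_nonneg, ?_, hw⟩
  · rw [← hlft e]
    exact h.measure_cyl_succ hw _
  · obtain ⟨f, hf⟩ := h.exists_measure_cyl_ne_zero hμ
    exact ⟨_, hw f ▸ hf⟩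

end IsConformalDensity

end ConformalDensity

/-- If the fundamental group is nontrivial, then a non-singular structure does not vanish, because
a maximal tree contains no closed reduced paths. -/
theorem IsNonsingular.exists_pos {Γ : Multigraph V A} {L : Dart A → ℝ} {p : V}
    (h : Γ.IsNonsingular L) {g : Γ.fundGroup p} (hg : g ≠ 1) : ∃ e, 0 < L e := by
  obtain ⟨T, hT, hpos⟩ := h
  by_contra! hL
  obtain ⟨l, hl, hmk⟩ := g.2
  obtain ⟨l', hl', hr, hmk', -⟩ := hl.exists_reduced
  have hmem : ∀ e : Dart A, e.1 ∈ T := fun e => by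
    by_contra he
    exact absurd (hpos e he) (not_lt.2 (hL e))
  have : l' = [] := (hT p p).unique ⟨hl', hr, fun e _ => hmem e⟩
    ⟨rfl, List.isChain_nil, fun e _ => hmem e⟩
  subst this
  exact hg (Subtype.ext (hmk.symm.trans hmk'.symm))

end Multigraph

theorem proposition4p5 {V A : Type*} [Finite V] [Fintype A] [DecidableEq A]
    (Γ : Multigraph V A) (hconn : Γ.IsConnected) (hdeg : ∀ v, Γ.degree v ≠ 1)
    (p : V) (k : ℕ) (hk : 2 ≤ k) (α : FreeGroup (Fin k) ≃* Γ.fundGroup p)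
    (L₀ : Multigraph.Dart A → ℝ)
    (hL₀ : (Multigraph.IsSemiMetric L₀ ∧ Γ.IsNonsingular L₀) ∨ Multigraph.IsPositive L₀)
    (y₀ : Multigraph.Dart A → ℝ) (s₀ : ℝ) (hs₀ : 0 < s₀) (hy₀ : ∀ e, 0 < y₀ e)
    (hsys : ∀ i, Γ.sysFun L₀ y₀ s₀ i = 0) :
    (Γ.jacobian L₀ y₀ s₀).det ≠ 0 ∧
    ∃ (U : Set (Multigraph.Dart A → ℝ)) (s : (Multigraph.Dart A → ℝ) → ℝ)
      (y : (Multigraph.Dart A → ℝ) → Multigraph.Dart A → ℝ),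
      IsOpen U ∧ L₀ ∈ U ∧
      AnalyticOnNhd ℝ s U ∧ (∀ e, AnalyticOnNhd ℝ (fun L => y L e) U) ∧
      s L₀ = s₀ ∧ y L₀ = y₀ ∧
      (∀ L ∈ U, ∀ i, Γ.sysFun L (y L) (s L) i = 0) ∧
      ∀ L ∈ U, Multigraph.IsSemiMetric L → Γ.IsNonsingular L →
        Γ.IsCriticalExponent p α L (s L) ∧
        ∀ (σ : ℝ) (μ : Γ.CoverVertex p → MeasureTheory.Measure (Γ.cover p).Boundary),
          0 < σ → Γ.IsConformalDensity p α L σ μ → (∃ x, μ x ≠ 0) →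
          ∃ c : ℝ, ∀ f : Multigraph.Dart (Γ.CoverEdge p),
            y L (Γ.proj p f) = c * (μ ((Γ.cover p).orig f)).real ((Γ.cover p).cyl f) := by
  have hcomm := Multigraph.exists_mul_ne_mul_of_freeGroup hk α
  have hirr := Multigraph.reflTransGen_follows hconn hdeg p hcomm
  obtain ⟨g, hg⟩ : ∃ g : Γ.fundGroup p, g ≠ 1 := by
    obtain ⟨g, h, hgh⟩ := hcomm
    exact ⟨g, fun h1 => hgh (by rw [h1, one_mul, mul_one])⟩
  have hne : Nonempty (Multigraph.Dart A) := by
    by_contra hempty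
    rw [not_nonempty_iff] at hempty
    have := hsys (Sum.inr ())
    simp [Multigraph.sysFun] at this
  have hLpos : (∀ e, 0 ≤ L₀ e) ∧ ∃ e, 0 < L₀ e := by
    rcases hL₀ with ⟨hsm, hns⟩ | hpos
    · exact ⟨hsm.1, hns.exists_pos hg⟩
    · exact ⟨fun e => (hpos e).le, hne.elim fun e => ⟨e, hpos e⟩⟩
  obtain ⟨hL0, e₁, he₁⟩ := hLpos
  have hdet := Multigraph.det_jacobian_ne_zero hirr hsys hy₀ hL0 he₁
  obtain ⟨U, s, y, hU, hLU, hs, hy, hs0, hy0, hsol, hpos⟩ :=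
    Multigraph.exists_analytic_solution hsys hs₀ hy₀ hdet
  refine ⟨hdet, U, s, y, hU, hLU, hs, hy, hs0, hy0, hsol, fun L hL hsm hns => ?_⟩
  have hfix := Multigraph.isFixedVector_of_sysFun (hsol L hL)
  obtain ⟨hsL, hyL⟩ := hpos L hL
  refine ⟨hfix.isCriticalExponent α hyL hsm.1 hsL.le hns hconn, fun σ μ _ hμ hμ0 => ?_⟩
  obtain ⟨w, hwfix, hw0, ⟨e₀, he₀⟩, hw⟩ := hμ.exists_fixedVector hconn hμ0
  have hwpos := hwfix.pos hirr hw0 he₀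
  obtain ⟨e₂, he₂⟩ := hns.exists_pos hg
  obtain rfl := hfix.exponent_unique hwfix hirr hyL hwpos hsm.1 he₂
  obtain ⟨c, hc⟩ := hfix.exists_eq_mul hwfix hirr hwpos
  exact ⟨c, fun f => by rw [hc, hw]⟩
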